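/- Let $n\ge 1$ be an integer, let $\mathbf d=(d_1,\dots,d_n)$ be positive integers and let $\boldsymbol\gamma=(\gamma_1,\dots,\gamma_n)\in\mathbb C^n$ with $\Re(\gamma_j)>0$ for all $j$. Assume that for all $j\in\{1,\dots,n\}$ and all $\varepsilon_{j+1},\dots,\varepsilon_n\in\{0,1\}$ the number $\frac1{d_j}+\sum_{k=j+1}^n\frac{\varepsilon_k}{d_k}$ is not a positive integer. Let $\zeta_{n,\mathbf d,\boldsymbol\gamma}(\mathbf s)$, $\mathbf s=(s_1,\dots,s_n)$, be the meromorphic continuation to $\mathbb C^n$ of the series $$\sum_{m_1,\dots,m_n\ge1}\ \prod_{j=1}^n\bigl(\gamma_1m_1^{d_1}+\dots+\gamma_jm_j^{d_j}\bigr)^{-s_j},$$ which converges absolutely for $\Re(s_j+\dots+s_n)>\frac1{d_j}+\dots+\frac1{d_n}$ $(1\le j\le n)$. Let the Bernoulli numbers be given by $\frac{X}{e^X-1}=\sum_{k\ge0}\frac{B_k}{k!}X^k$, let $\boldsymbol 0_k$ be the zero vector of length $k$, and let empty sums be zero. Then this continuation exists, the points $\boldsymbol 0_n$, $(\boldsymbol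 0_{n-1},-1)$ and $(\boldsymbol 0_{n-1},-2)$ are regular points of it, and 1. $\displaystyle \zeta_{n,\mathbf d,\boldsymbol\gamma}(\boldsymbol 0_n)=\left(-\tfrac12\right)^n$; 2. $\displaystyle \zeta_{n,\mathbf d,\boldsymbol\gamma}(\boldsymbol 0_{n-1},-1)=\left(-\tfrac12\right)^{n-1}\left(\frac{(-1)^{d_1}B_{d_1+1}}{d_1+1}\gamma_1-\sum_{j=2}^n\frac{B_{d_j+1}}{d_j+1}\gamma_j\right)$; 3. $\displaystyle \zeta_{n,\mathbf d,\boldsymbol\gamma}(\boldsymbol 0_{n-1},-2)=\left(-\tfrac12\right)^{n-1}\frac{B_{2d_1+1}}{2d_1+1}\gamma_1^2-2\left(-\tfrac12\right)^{n-2}\sum_{k=2}^n\frac{B_{d_k+1}}{d_k+1}\gamma_k\left(\frac{(-1)^{d_1}B_{d_1+1}}{d_1+1}\gamma_1-\sum_{j=2}^{k-1}\frac{B_{d_j+1}}{d_j+1}\gamma_j\right)$. -/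

import Mathlib

open Filter Topology

noncomputable section

/-- `F` is meromorphic on `ℂⁿ`: near every point it is a quotient of two holomorphic functions, the
denominator not vanishing identically near the point.  The values of `F` on the (nowhere dense) zero
set of the denominator are irrelevant. -/
def IsMeromorphicSeveral {n : ℕ} (F : (Fin n → ℂ) → ℂ) : Prop :=
  ∀ z : Fin n → ℂ, ∃ g h : (Fin n → ℂ) → ℂ,
    AnalyticAt ℂ g z ∧ AnalyticAt ℂ h z ∧ (¬ ∀ᶠ w in 𝓝 z, h w = 0) ∧
      ∀ᶠ w in 𝓝 z, h w ≠ 0 → F w = g w / h w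

/-- `z` is a regular point of the meromorphic function `F`, and `v` is the value there: outside the
zero set of a holomorphic function that does not vanish identically near `z`, the function `F` agrees
near `z` with a function `φ` that is holomorphic at `z`, and `φ z = v`. -/
def HasRegularValueAt {n : ℕ} (F : (Fin n → ℂ) → ℂ) (z : Fin n → ℂ) (v : ℂ) : Prop :=
  ∃ φ h : (Fin n → ℂ) → ℂ,
    AnalyticAt ℂ φ z ∧ AnalyticAt ℂ h z ∧ (¬ ∀ᶠ w in 𝓝 z, h w = 0) ∧
      (∀ᶠ w in 𝓝 z, h w ≠ 0 → F w = φ w) ∧ φ z = v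

/-- The term `1 / ∏ⱼ (γ₁ m₁^d₁ + ⋯ + γⱼ mⱼ^dⱼ)^sⱼ` of the series, with principal powers (the bases
have positive real part when all `γⱼ` do). -/
def multiZetaTerm {n : ℕ} (d : Fin n → ℕ) (γ : Fin n → ℂ) (s : Fin n → ℂ) (m : Fin n → ℕ+) : ℂ :=
  1 / ∏ j, (∑ i ∈ Finset.Iic j, γ i * ((m i : ℕ) : ℂ) ^ d i) ^ s j

/-- The domain `Re (sⱼ + ⋯ + sₙ) > 1/dⱼ + ⋯ + 1/dₙ` for `1 ≤ j ≤ n`. -/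
def multiZetaDomain {n : ℕ} (d : Fin n → ℕ) : Set (Fin n → ℂ) :=
  {s | ∀ j, ∑ i ∈ Finset.Ici j, (1 / (d i : ℝ)) < (∑ i ∈ Finset.Ici j, s i).re}

/-- `Z` is the meromorphic continuation to `ℂⁿ` of the multiple zeta-function with parameters
`d`, `γ`: it is meromorphic on `ℂⁿ`, and on the domain of absolute convergence it is the sum of the
(absolutely convergent) multiple series. -/
def IsMultiZeta {n : ℕ} (d : Fin n → ℕ) (γ : Fin n → ℂ) (Z : (Fin n → ℂ) → ℂ) : Prop :=
  IsMeromorphicSeveral Z ∧ ∀ s ∈ multiZetaDomain d, HasSum (multiZetaTerm d γ s) (Z s)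

/-- For all `j` and all `ε_{j+1}, …, ε_n ∈ {0, 1}`, the number `1/dⱼ + ∑_{k > j} ε_k / d_k` is not a
positive integer. -/
def NonIntegralSums {n : ℕ} (d : Fin n → ℕ) : Prop :=
  ∀ (j : Fin n) (ε : Fin n → ℕ), (∀ k, ε k = 0 ∨ ε k = 1) →
    ∀ N : ℕ, 1 ≤ N → 1 / (d j : ℚ) + ∑ k ∈ Finset.Ioi j, (ε k : ℚ) / (d k : ℚ) ≠ (N : ℚ)

end

/-! The series is summed one variable at a time, starting with the last. With A the part of the last
base that involves the earlier variables, the inner sum Σ_m (A + γ m^d)^(-s) is, up to 1/Γ(s), the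
Mellin transform of e^(-At) θ(t), where θ(t) = Σ_m exp(-γ t m^d). Euler–Maclaurin gives θ(t) = c
t^(-1/d) + Σ_{k<K} ζ(-dk) (-γt)^k/k! + O(t^K). Hence the inner sum equals c Γ(s-1/d)/Γ(s) ·
A^(1/d-s), plus Σ_{k<K} ζ(-dk) (-γ)^k/k! · s(s+1)⋯(s+k-1) A^(-s-k), plus a remainder of size (Re
A)^(-Re s-K) that carries the factor 1/Γ(s) (`hasSum_cpow_add_mul_pow`).

Each power of A merges with the preceding exponent. So the zeta function in n variables becomes a
combination of zeta functions in n-1 variables at shifted arguments, plus a series of remainders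
that is holomorphic far to the left when K is large (`multiZetaSum_eq`). The case of one variable is
γ^(-s) ζ(ds). By induction every region `tailRegion n L` carries the continuation as a fraction with
entire denominator (`exists_hasFractionOn_multiZetaSum`). The denominators do not vanish at
(0,…,0,x) unless x is, modulo integers, one of the sums 1/d_j + Σ ε_k/d_k; the hypothesis on d
excludes this for x = -N.

At s_n = -N the factor 1/Γ(s_n) removes both the Gamma term and the remainder, and the rising
factorial removes all k > N. What is left is the finite recursion `multiZetaVal`, solved for N = 0,
1, 2 with ζ(0) = -1/2, the Bernoulli values of ζ(-d), and ζ(-2d) = 0.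

The regions are convex and exhaust the space, so the fractions glue to a meromorphic function
(`exists_isMeromorphicSeveral`). A connectedness argument shows that every meromorphic continuation
has the regular value read off from the fraction (`IsMeromorphicSeveral.hasRegularValueAt`). -/

/-! ### Cauchy's formula on polydiscs and holomorphic series in several variables -/

-- Induction on the dimension: for fixed first coordinate the inner torus integral is evaluated by
-- the induction hypothesis, and the one-variable Cauchy formula handles the remaining circle.
open MeasureTheory Complex in
theorem cauchy_torusIntegral {n : ℕ} {f : (Fin n → ℂ) → ℂ} {c : Fin n → ℂ} {R : ℝ} (hR : 0 < R)
    (hc : ContinuousOn f (Metric.closedBall c R))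
    (hd : ∀ z ∈ Metric.closedBall c R, ∀ i,
      DifferentiableOn ℂ (fun w => f (Function.update z i w)) (Metric.ball (c i) R))
    {w : Fin n → ℂ} (hw : w ∈ Metric.ball c R) :
    (∯ x in T(c, fun _ => R), (∏ i, (x i - w i)⁻¹) * f x) = (2 * Real.pi * I) ^ n * f w := by
  have hmap : ∀ {m : ℕ} (c : Fin m → ℂ) θ, torusMap c (fun _ => R) θ ∈ Metric.closedBall c R := by
    intro m c θ
    rw [mem_closedBall_iff_norm, torusMap_sub_center, pi_norm_le_iff_of_nonneg hR.le]
    intro i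
    simp [torusMap, Complex.norm_exp_ofReal_mul_I, abs_of_pos hR]
  have hcm : ∀ {m : ℕ} (c : Fin m → ℂ), Continuous (torusMap c (fun _ => R)) := by
    intro m c; unfold torusMap; fun_prop
  induction n with
  | zero =>
    simp [torusIntegral_dim0]
    congr 1; exact Subsingleton.elim _ _
  | succ n ih =>
    have hw' := hw
    rw [ball_pi _ hR, Set.mem_univ_pi] at hw
    have hne : ∀ x ∈ Metric.sphere (c 0) R, x - w 0 ≠ 0 := by
      intro x hx h
      have := hw 0
      rw [← sub_eq_zero.1 h] at this
      exact absurd (Metric.mem_sphere.1 hx) (ne_of_lt (Metric.mem_ball.1 this))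
    have hint : TorusIntegrable (fun x => (∏ i, (x i - w i)⁻¹) * f x) c (fun _ => R) := by
      refine ContinuousOn.integrableOn_compact isCompact_Icc ?_
      refine ContinuousOn.mul (Continuous.continuousOn ?_)
        (hc.comp (hcm c).continuousOn fun θ _ => hmap c θ)
      refine continuous_finsetProd _ fun i _ => Continuous.inv₀ ?_ ?_
      · exact ((continuous_apply i).comp (hcm c)).sub continuous_const
      · intro θ h
        have := hw i
        rw [← sub_eq_zero.1 h] at this
        simp [torusMap, Complex.norm_exp_ofReal_mul_I, abs_of_pos hR] at this
    rw [torusIntegral_succ hint]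
    have hcons : ∀ x ∈ Metric.closedBall (c 0) R, ∀ y ∈ Metric.closedBall (c ∘ Fin.succ) R,
        (Fin.cons x y : Fin (n + 1) → ℂ) ∈ Metric.closedBall c R := by
      intro x hx y hy
      rw [closedBall_pi _ hR.le, Set.mem_univ_pi] at hy ⊢
      intro i
      refine Fin.cases ?_ (fun i => ?_) i
      · simpa using hx
      · simpa using hy i
    have hwt : w ∘ Fin.succ ∈ Metric.ball (c ∘ Fin.succ) R := by
      rw [ball_pi _ hR, Set.mem_univ_pi]
      exact fun i => hw i.succ
    have key : ∀ x ∈ Metric.sphere (c 0) R,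
        (∯ y in T(c ∘ Fin.succ, fun _ => R),
          (∏ i, ((Fin.cons x y : Fin (n + 1) → ℂ) i - w i)⁻¹) * f (Fin.cons x y))
        = (x - w 0)⁻¹ • ((2 * Real.pi * I) ^ n * f (Fin.cons x (w ∘ Fin.succ))) := by
      intro x hx
      have hx' := Metric.sphere_subset_closedBall hx
      simp only [Fin.prod_univ_succ, Fin.cons_zero, Fin.cons_succ, mul_assoc (x - w 0)⁻¹]
      rw [torusIntegral_const_mul, smul_eq_mul]
      congr 1
      refine ih (f := fun y => f (Fin.cons x y)) (c := c ∘ Fin.succ) (w := w ∘ Fin.succ) ?_ ?_ hwt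
      · refine hc.comp (Continuous.continuousOn ?_) fun y hy => hcons x hx' y hy
        exact (continuous_const.finCons continuous_id)
      · intro z hz i
        have := hd _ (hcons x hx' z hz) i.succ
        simp only [← Fin.cons_update] at this
        exact this
    have e1 : (∮ x in C(c 0, R), ∯ y in T(c ∘ Fin.succ, fun _ => R),
          (∏ i, ((Fin.cons x y : Fin (n + 1) → ℂ) i - w i)⁻¹) * f (Fin.cons x y))
        = ∮ x in C(c 0, R), (x - w 0)⁻¹ • ((2 * Real.pi * I) ^ n * f (Fin.cons x (w ∘ Fin.succ))) :=
      circleIntegral.integral_congr hR.le key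
    refine e1.trans ?_
    have hslice : ContinuousOn (fun x : ℂ => f (Fin.cons x (w ∘ Fin.succ)))
        (Metric.closedBall (c 0) R) := by
      refine hc.comp (Continuous.continuousOn ?_)
        fun x hx => hcons x hx _ (Metric.ball_subset_closedBall hwt)
      exact Continuous.finCons (A := fun _ => ℂ) continuous_id continuous_const
    have hsl2 : DifferentiableOn ℂ (fun x : ℂ => f (Fin.cons x (w ∘ Fin.succ)))
        (Metric.ball (c 0) R) := by
      have := hd w (Metric.ball_subset_closedBall hw') 0
      refine this.congr fun x _ => ?_
      congr 1
      ext i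
      refine Fin.cases ?_ (fun i => ?_) i <;> simp
    have := circleIntegral_sub_inv_smul_of_differentiable_on_off_countable
      (f := fun x : ℂ => (2 * Real.pi * I) ^ n * f (Fin.cons x (w ∘ Fin.succ)))
      Set.countable_empty (hw 0) (continuousOn_const.mul hslice)
      (fun x hx => ((differentiableOn_const _).mul hsl2).differentiableAt
        (Metric.isOpen_ball.mem_nhds hx.1))
    rw [this]
    have e2 : (Fin.cons (w 0) (w ∘ Fin.succ) : Fin (n + 1) → ℂ) = w := by
      ext i
      refine Fin.cases ?_ (fun i => ?_) i <;> simp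
    simp only [e2, smul_eq_mul]
    ring

open MeasureTheory Complex in
/-- Osgood's lemma: a continuous, separately holomorphic function is analytic. -/
theorem analyticAt_of_continuousOn_of_separately {n : ℕ} {f : (Fin n → ℂ) → ℂ} {c : Fin n → ℂ}
    {R : ℝ} (hR : 0 < R) (hc : ContinuousOn f (Metric.closedBall c R))
    (hd : ∀ z ∈ Metric.closedBall c R, ∀ i,
      DifferentiableOn ℂ (fun w => f (Function.update z i w)) (Metric.ball (c i) R)) :
    AnalyticAt ℂ f c := by
  let K : Set (Fin n → ℝ) := Set.Icc 0 fun _ => 2 * Real.pi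
  have : CompactSpace K := isCompact_iff_compactSpace.1 isCompact_Icc
  let ν : Measure K := Measure.comap Subtype.val volume
  have hν : IsFiniteMeasure ν := ⟨by
    rw [Measure.comap_apply _ Subtype.val_injective
      (fun s hs => measurableSet_Icc.subtype_image hs) _ MeasurableSet.univ]
    rw [Set.image_univ, Subtype.range_coe]
    exact isCompact_Icc.measure_lt_top⟩
  have hi : ∀ g : C(K, ℂ), Integrable g ν := fun g =>
    (integrable_const ‖g‖).mono' g.continuous.aestronglyMeasurable
      (Eventually.of_forall fun x => g.norm_coe_le_norm x)
  let Λ₀ : C(K, ℂ) →ₗ[ℂ] ℂ :=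
    { toFun := fun g => ∫ θ, g θ ∂ν
      map_add' := fun g h => integral_add (hi g) (hi h)
      map_smul' := fun a g => by simp [integral_const_mul] }
  let Λ : C(K, ℂ) →L[ℂ] ℂ := Λ₀.mkContinuous (ν.real Set.univ) fun g => by
    rw [mul_comm]
    exact norm_integral_le_of_norm_le_const (Eventually.of_forall fun x => g.norm_coe_le_norm x)
  have hcm : Continuous (torusMap c (fun _ => R)) := by unfold torusMap; fun_prop
  have hmap : ∀ θ, torusMap c (fun _ => R) θ ∈ Metric.closedBall c R := by
    intro θ
    rw [mem_closedBall_iff_norm, torusMap_sub_center, pi_norm_le_iff_of_nonneg hR.le]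
    intro i
    simp [torusMap, Complex.norm_exp_ofReal_mul_I, abs_of_pos hR]
  let ζ : Fin n → C(K, ℂ) := fun i =>
    ⟨fun θ => torusMap c (fun _ => R) θ i, (continuous_apply i).comp
      (hcm.comp continuous_subtype_val)⟩
  let q : C(K, ℂ) :=
    ⟨fun θ => (∏ i, (R : ℂ) * exp (θ.1 i * I) * I) * f (torusMap c (fun _ => R) θ),
      Continuous.mul (continuous_finsetProd _ fun i _ =>
        (continuous_const.mul (((continuous_ofReal.comp ((continuous_apply i).comp
          continuous_subtype_val)).mul continuous_const).cexp)).mul continuous_const)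
        (hc.comp_continuous (hcm.comp continuous_subtype_val) fun θ => hmap θ)⟩
  -- The Cauchy integrand as an element of the Banach algebra C(K, ℂ), with K the cube of angles.
  -- Inversion is analytic on units, so Φ is analytic in w; integration over K is a continuous
  -- linear functional, so the integral is analytic too, and no power series has to be written down.
  let Φ : (Fin n → ℂ) → C(K, ℂ) := fun w =>
    q * ∏ i, Ring.inverse (ζ i - algebraMap ℂ C(K, ℂ) (w i))
  have hunit : ∀ w ∈ Metric.ball c R, ∀ i, IsUnit (ζ i - algebraMap ℂ C(K, ℂ) (w i)) := by
    intro w hw i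
    rw [ContinuousMap.isUnit_iff_forall_ne_zero]
    intro θ h
    rw [ball_pi _ hR, Set.mem_univ_pi] at hw
    have h1 : torusMap c (fun _ => R) θ i = w i := sub_eq_zero.1 h
    have := hw i
    rw [← h1] at this
    simp [torusMap, Complex.norm_exp_ofReal_mul_I, abs_of_pos hR] at this
  have hinv : ∀ w ∈ Metric.ball c R, ∀ i θ,
      Ring.inverse (ζ i - algebraMap ℂ C(K, ℂ) (w i)) θ
        = (torusMap c (fun _ => R) θ i - w i)⁻¹ := by
    intro w hw i θ
    have h1 := DFunLike.congr_fun (Ring.mul_inverse_cancel _ (hunit w hw i)) θ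
    exact eq_inv_of_mul_eq_one_right h1
  have hΦ : AnalyticAt ℂ Φ c := by
    refine analyticAt_const.mul (Finset.analyticAt_fun_prod _ fun i _ => ?_)
    refine AnalyticAt.fun_comp (f := fun w : Fin n → ℂ => ζ i - algebraMap ℂ C(K, ℂ) (w i))
      (analyticOnNhd_inverse (𝕜 := ℂ) (ζ i - algebraMap ℂ C(K, ℂ) (c i))
        (hunit c (Metric.mem_ball_self hR) i)) ?_
    refine analyticAt_const.sub ?_
    exact ((Algebra.linearMap ℂ C(K, ℂ)).toContinuousLinearMap.analyticAt _).fun_comp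
      ((ContinuousLinearMap.proj (R := ℂ) (φ := fun _ : Fin n => ℂ) i).analyticAt c)
  have h2 : AnalyticAt ℂ (fun w => ((2 * Real.pi * I) ^ n)⁻¹ * Λ (Φ w)) c :=
    analyticAt_const.mul ((Λ.analyticAt _).fun_comp hΦ)
  refine h2.congr ?_
  filter_upwards [Metric.ball_mem_nhds c hR] with w hw
  have h3 : (2 * Real.pi * I : ℂ) ^ n ≠ 0 := pow_ne_zero _ (by simp [Real.pi_ne_zero])
  rw [inv_mul_eq_iff_eq_mul₀ h3, ← cauchy_torusIntegral hR hc hd hw, torusIntegral,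
    ← integral_subtype_comap measurableSet_Icc]
  refine integral_congr_ae (Eventually.of_forall fun θ => ?_)
  have h4 : (Φ w) θ = q θ * ∏ i, (Ring.inverse (ζ i - algebraMap ℂ C(K, ℂ) (w i))) θ := by
    simp [Φ, ContinuousMap.prod_apply]
  simp only [h4, hinv w hw, smul_eq_mul]
  simp only [q, ContinuousMap.coe_mk]
  ring

open Complex in
/-- A locally normally convergent series of holomorphic functions of several variables is
holomorphic. -/
theorem analyticOnNhd_tsum_of_locally_summable {n : ℕ} {ι : Type*} {F : ι → (Fin n → ℂ) → ℂ}
    {U : Set (Fin n → ℂ)} (hU : IsOpen U) (hF : ∀ i, DifferentiableOn ℂ (F i) U)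
    (hb : ∀ z ∈ U, ∃ V ∈ 𝓝 z, ∃ u : ι → ℝ, Summable u ∧ ∀ i, ∀ w ∈ V, ‖F i w‖ ≤ u i) :
    AnalyticOnNhd ℂ (fun w => ∑' i, F i w) U := by
  intro c hc
  obtain ⟨V, hV, u, hu, hle⟩ := hb c hc
  obtain ⟨R, hR, hRV⟩ := Metric.nhds_basis_closedBall.mem_iff.1
    (inter_mem hV (hU.mem_nhds hc))
  refine analyticAt_of_continuousOn_of_separately hR ?_ ?_
  · exact continuousOn_tsum (fun i => (hF i).continuousOn.mono fun w hw => (hRV hw).2) hu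
      fun i w hw => hle i w (hRV hw).1
  · intro z hz i
    have hmaps : ∀ w ∈ Metric.ball (c i) R, Function.update z i w ∈ Metric.closedBall c R := by
      intro w hw
      rw [closedBall_pi _ hR.le, Set.mem_univ_pi] at hz ⊢
      intro j
      rcases eq_or_ne j i with rfl | hj
      · simpa using (Metric.mem_ball.1 hw).le
      · simpa [hj] using hz j
    refine differentiableOn_tsum_of_summable_norm hu (fun k => ?_) Metric.isOpen_ball
      fun k w hw => hle k _ (hRV (hmaps w hw)).1
    intro w hw
    have h1 : DifferentiableAt ℂ (F k) (Function.update z i w) :=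
      (hF k).differentiableAt (hU.mem_nhds (hRV (hmaps w hw)).2)
    exact (h1.comp w (hasFDerivAt_update z w).differentiableAt).differentiableWithinAt

/-! ### Euler–Maclaurin summation -/

-- Integration by parts, since B_(J+1)(x)/(J+1)! has derivative B_J(x)/J!.
open MeasureTheory in
theorem integral_bernoulliFun_mul_eq {f f' : ℝ → ℂ} (hf : ∀ x, HasDerivAt f (f' x) x)
    (hf' : Continuous f') (J : ℕ) (a : ℝ) :
    ∫ x in a..(a + 1), ((bernoulliFun J (x - a) / J.factorial : ℝ) : ℂ) * f x
      = ((bernoulliFun (J + 1) 1 / (J + 1).factorial : ℝ) : ℂ) * f (a + 1)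
        - ((bernoulliFun (J + 1) 0 / (J + 1).factorial : ℝ) : ℂ) * f a
        - ∫ x in a..(a + 1), ((bernoulliFun (J + 1) (x - a) / (J + 1).factorial : ℝ) : ℂ) * f' x := by
  have hu : ∀ x, HasDerivAt
      (fun x => ((bernoulliFun (J + 1) (x - a) / (J + 1).factorial : ℝ) : ℂ))
      ((bernoulliFun J (x - a) / J.factorial : ℝ) : ℂ) x := by
    intro x
    have h1 := ((hasDerivAt_bernoulliFun (J + 1) (x - a)).comp_sub_const x a).div_const
      ((J + 1).factorial : ℝ)
    convert h1.ofReal_comp using 1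
    have : ((J.factorial : ℕ) : ℝ) ≠ 0 := by positivity
    rw [Nat.factorial_succ]
    push_cast
    field_simp
  have hb : Continuous fun x => ((bernoulliFun J (x - a) / J.factorial : ℝ) : ℂ) :=
    Complex.continuous_ofReal.comp
      (((continuous_bernoulliFun (k := J)).comp (continuous_sub_right a)).div_const _)
  have := intervalIntegral.integral_mul_deriv_eq_deriv_mul (a := a) (b := a + 1)
    (fun x _ => hu x) (fun x _ => hf x) (hb.intervalIntegrable _ _) (hf'.intervalIntegrable _ _)
  rw [this]
  simp

-- Euler–Maclaurin on [0, M], by repeated integration by parts on unit intervals. Writing the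
-- coefficients as ζ(-j)/j! instead of Bernoulli numbers is what later turns them into zeta values.
open MeasureTheory in
theorem sum_eq_integral_add_bernoulli {F : ℕ → ℝ → ℂ}
    (hF : ∀ j x, HasDerivAt (F j) (F (j + 1) x) x) (J M : ℕ) :
    ∑ m ∈ Finset.range M, F 0 (m + 1) = (∫ x in (0 : ℝ)..M, F 0 x)
      - ∑ j ∈ Finset.range (J + 1), riemannZeta (-j) / j.factorial * (F j M - F j 0)
      + (-1) ^ J * ∑ m ∈ Finset.range M, ∫ x in (m : ℝ)..(m + 1),
          ((bernoulliFun (J + 1) (x - m) / (J + 1).factorial : ℝ) : ℂ) * F (J + 1) x := by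
  have hcont : ∀ j, Continuous (F j) := fun j =>
    continuous_iff_continuousAt.2 fun x => (hF j x).continuousAt
  have hz : ∀ j : ℕ, riemannZeta (-j) / j.factorial
      = (-1) ^ j * ((bernoulliFun (j + 1) 0 / (j + 1).factorial : ℝ) : ℂ) := by
    intro j
    rw [riemannZeta_neg_nat_eq_bernoulli, bernoulliFun_eval_zero, Nat.factorial_succ]
    have h1 : (j.factorial : ℂ) ≠ 0 := by exact_mod_cast j.factorial_ne_zero
    have h2 : (j + 1 : ℂ) ≠ 0 := by exact_mod_cast j.succ_ne_zero
    push_cast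
    field_simp
  have htel : ∀ j, ∑ m ∈ Finset.range M, (F j (m + 1) - F j m) = F j M - F j 0 := by
    intro j
    have := Finset.sum_range_sub (fun m : ℕ => F j m) M
    simpa using this
  induction J with
  | zero =>
    have h0 : (∫ x in (0 : ℝ)..M, F 0 x)
        = ∑ m ∈ Finset.range M, ∫ x in (m : ℝ)..(m + 1), F 0 x := by
      have := intervalIntegral.sum_integral_adjacent_intervals (f := F 0) (μ := volume)
        (a := fun m : ℕ => (m : ℝ)) (n := M) fun k _ => (hcont 0).intervalIntegrable _ _
      simpa using this.symm
    -- B_1 takes the different values 1/2 and -1/2 at the two ends. From B_2 on the end values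
    -- agree, so in the inductive step the boundary terms telescope directly.
    have h1 : ∀ m : ℕ, ∫ x in (m : ℝ)..(m + 1), F 0 x = F 0 (m + 1) - 2⁻¹ * (F 0 (m + 1) - F 0 m)
        - ∫ x in (m : ℝ)..(m + 1),
          ((bernoulliFun (0 + 1) (x - m) / (0 + 1).factorial : ℝ) : ℂ) * F (0 + 1) x := by
      intro m
      have := integral_bernoulliFun_mul_eq (hF 0) (hcont 1) 0 m
      simp only [bernoulliFun_zero, zero_add, Nat.factorial_one, bernoulliFun_one] at this ⊢
      norm_num at this ⊢
      rw [this]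
      ring
    rw [h0, Finset.sum_congr rfl fun m _ => h1 m, Finset.sum_sub_distrib, Finset.sum_sub_distrib,
      ← Finset.mul_sum, htel]
    simp [riemannZeta_zero]
    ring
  | succ J ih =>
    have h1 : ∀ m : ℕ, (∫ x in (m : ℝ)..(m + 1),
          ((bernoulliFun (J + 1) (x - m) / (J + 1).factorial : ℝ) : ℂ) * F (J + 1) x)
        = ((bernoulliFun (J + 2) 0 / (J + 2).factorial : ℝ) : ℂ) * (F (J + 1) (m + 1) - F (J + 1) m)
        - ∫ x in (m : ℝ)..(m + 1),
          ((bernoulliFun (J + 2) (x - m) / (J + 2).factorial : ℝ) : ℂ) * F (J + 2) x := by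
      intro m
      rw [integral_bernoulliFun_mul_eq (hF (J + 1)) (hcont (J + 2)) (J + 1) m,
        bernoulliFun_eval_one, if_neg (by omega), add_zero]
      ring
    rw [ih, Finset.sum_congr rfl fun m _ => h1 m, Finset.sum_sub_distrib, ← Finset.mul_sum, htel,
      Finset.sum_range_succ _ (J + 1), hz (J + 1)]
    ring

open MeasureTheory in
/-- The Euler–Maclaurin expansion on the half-line, with an integral bound for the remainder. -/
theorem exists_norm_tsum_sub_integral_le (J : ℕ) :
    ∃ B : ℝ, 0 ≤ B ∧ ∀ F : ℕ → ℝ → ℂ, (∀ j x, HasDerivAt (F j) (F (j + 1) x) x) →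
      (∀ j, IntegrableOn (F j) (Set.Ioi 0)) → Summable (fun m : ℕ => F 0 (m + 1)) →
      ‖∑' m : ℕ, F 0 (m + 1) - (∫ x in Set.Ioi (0 : ℝ), F 0 x)
        - ∑ j ∈ Finset.range (J + 1), riemannZeta (-j) / j.factorial * F j 0‖
        ≤ B * ∫ x in Set.Ioi (0 : ℝ), ‖F (J + 1) x‖ := by
  obtain ⟨B, hB⟩ := (isCompact_Icc (a := (0 : ℝ)) (b := 1)).exists_bound_of_continuousOn
    (f := fun x => bernoulliFun (J + 1) x / (J + 1).factorial)
    ((continuous_bernoulliFun (k := J + 1)).div_const _).continuousOn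
  have hB0 : 0 ≤ B := (norm_nonneg _).trans (hB 0 (by simp))
  refine ⟨B, hB0, fun F hF hint hsum => ?_⟩
  have hcont : ∀ j, Continuous (F j) := fun j =>
    continuous_iff_continuousAt.2 fun x => (hF j x).continuousAt
  -- Integrability of a function together with its derivative forces decay, so the boundary terms at
  -- M disappear in the limit.
  have hlim0 : ∀ j, Tendsto (F j) atTop (𝓝 0) := fun j =>
    tendsto_zero_of_hasDerivAt_of_integrableOn_Ioi (fun x _ => hF j x) (hint _) (hint _)
  have hT : Tendsto (fun M : ℕ => (∑ m ∈ Finset.range M, F 0 (m + 1)) - (∫ x in (0 : ℝ)..M, F 0 x)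
      + ∑ j ∈ Finset.range (J + 1), riemannZeta (-j) / j.factorial * (F j M - F j 0)) atTop
      (𝓝 ((∑' m : ℕ, F 0 (m + 1)) - (∫ x in Set.Ioi (0 : ℝ), F 0 x)
        + ∑ j ∈ Finset.range (J + 1), riemannZeta (-j) / j.factorial * (0 - F j 0))) := by
    refine Tendsto.add (Tendsto.sub hsum.hasSum.tendsto_sum_nat
      (intervalIntegral_tendsto_integral_Ioi 0 (hint 0) tendsto_natCast_atTop_atTop)) ?_
    refine tendsto_finsetSum _ fun j _ => Tendsto.const_mul _ (Tendsto.sub_const ?_ _)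
    exact (hlim0 j).comp tendsto_natCast_atTop_atTop
  have hlim : (∑' m : ℕ, F 0 (m + 1)) - (∫ x in Set.Ioi (0 : ℝ), F 0 x)
        + ∑ j ∈ Finset.range (J + 1), riemannZeta (-j) / j.factorial * (0 - F j 0)
      = ∑' m : ℕ, F 0 (m + 1) - (∫ x in Set.Ioi (0 : ℝ), F 0 x)
        - ∑ j ∈ Finset.range (J + 1), riemannZeta (-j) / j.factorial * F j 0 := by
    simp only [zero_sub, mul_neg, Finset.sum_neg_distrib]
    ring
  rw [← hlim]
  refine le_of_tendsto hT.norm (Eventually.of_forall fun M => ?_)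
  rw [sum_eq_integral_add_bernoulli hF J M]
  have h1 : ∀ a b c : ℂ, a - b + c - a + b = c := fun a b c => by ring
  rw [h1, norm_mul, norm_pow, norm_neg, norm_one, one_pow, one_mul]
  have hn : ∀ a b : ℝ, IntervalIntegrable (fun x => ‖F (J + 1) x‖) volume a b := fun a b =>
    (hcont _).norm.intervalIntegrable _ _
  calc _ ≤ ∑ m ∈ Finset.range M, B * ∫ x in (m : ℝ)..(m + 1), ‖F (J + 1) x‖ := by
        refine norm_sum_le_of_le _ fun m _ => ?_
        rw [← intervalIntegral.integral_const_mul]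
        refine intervalIntegral.norm_integral_le_of_norm_le (by linarith)
          (Eventually.of_forall fun x hx => ?_) ((hn _ _).const_mul _)
        rw [norm_mul, Complex.norm_real]
        exact mul_le_mul_of_nonneg_right (hB _ ⟨by linarith [hx.1], by linarith [hx.2]⟩)
          (norm_nonneg _)
    _ = B * ∫ x in (0 : ℝ)..M, ‖F (J + 1) x‖ := by
        rw [← Finset.mul_sum]
        have := intervalIntegral.sum_integral_adjacent_intervals (f := fun x => ‖F (J + 1) x‖)
          (μ := volume) (a := fun m : ℕ => (m : ℝ)) (n := M) fun k _ => hn _ _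
        congr 1
        simpa using this
    _ ≤ _ := by
        refine mul_le_mul_of_nonneg_left ?_ hB0
        rw [intervalIntegral.integral_of_le (by positivity)]
        exact setIntegral_mono_set (hint _).norm (Eventually.of_forall fun x => norm_nonneg _)
          (Eventually.of_forall fun x hx => hx.1)

-- Euler–Maclaurin for x ↦ G(hx): each derivative contributes a factor h, and rescaling the integral
-- costs 1/h, so the remainder h^(J+1) · h⁻¹ is of order h^J.
open MeasureTheory in
theorem exists_norm_tsum_scaled_sub_le (J : ℕ) {G : ℕ → ℝ → ℂ}
    (hG : ∀ j x, HasDerivAt (G j) (G (j + 1) x) x) (hint : ∀ j, IntegrableOn (G j) (Set.Ioi 0))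
    (hsum : ∀ h : ℝ, 0 < h → Summable (fun m : ℕ => G 0 (h * (m + 1)))) :
    ∃ C : ℝ, 0 ≤ C ∧ ∀ h : ℝ, 0 < h →
      ‖∑' m : ℕ, G 0 (h * (m + 1)) - (h : ℂ)⁻¹ * (∫ x in Set.Ioi (0 : ℝ), G 0 x)
        - ∑ j ∈ Finset.range (J + 1), riemannZeta (-j) / j.factorial * ((h : ℂ) ^ j * G j 0)‖
        ≤ C * h ^ J := by
  obtain ⟨B, hB0, hB⟩ := exists_norm_tsum_sub_integral_le J
  refine ⟨B * ∫ x in Set.Ioi (0 : ℝ), ‖G (J + 1) x‖,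
    mul_nonneg hB0 (integral_nonneg fun x => norm_nonneg _), fun h hh => ?_⟩
  have hi : ∀ j, IntegrableOn (fun x => G j (h * x)) (Set.Ioi 0) := fun j => by
    rw [integrableOn_Ioi_comp_mul_left_iff _ _ hh, mul_zero]
    exact hint j
  have := hB (fun j x => (h : ℂ) ^ j * G j (h * x)) (fun j x => by
    have h1 := ((hG j (h * x)).scomp x ((hasDerivAt_id x).const_mul h)).const_mul ((h : ℂ) ^ j)
    refine h1.congr_deriv ?_
    rw [mul_one, Complex.real_smul, pow_succ]
    ring) (fun j => (hi j).const_mul _) (by simpa using hsum h hh)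
  simp only [pow_zero, one_mul, mul_zero, integral_comp_mul_left_Ioi _ _ hh, norm_mul, norm_pow,
    Complex.norm_real, integral_const_mul,
    integral_comp_mul_left_Ioi (fun x => ‖G (J + 1) x‖) _ hh] at this
  rw [Complex.real_smul, Complex.ofReal_inv] at this
  refine this.trans (le_of_eq ?_)
  rw [Real.norm_of_nonneg hh.le, smul_eq_mul, pow_succ]
  field_simp

/-! ### Derivatives of exp(c y^d) -/

/-- The polynomials `P` with `(d/dy)^j exp (c y^d) = P_j(y) exp (c y^d)`. -/
noncomputable def expPowPoly (d : ℕ) (c : ℂ) : ℕ → Polynomial ℂ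
  | 0 => 1
  | j + 1 => (expPowPoly d c j).derivative
      + Polynomial.C (c * d) * Polynomial.X ^ (d - 1) * expPowPoly d c j

/-- The `j`-th derivative of `y ↦ exp (c y^d)`. -/
noncomputable def expPowDeriv (d : ℕ) (c : ℂ) (j : ℕ) (y : ℝ) : ℂ :=
  (expPowPoly d c j).eval (y : ℂ) * Complex.exp (c * y ^ d)

theorem expPowDeriv_zero (d : ℕ) (c : ℂ) (y : ℝ) :
    expPowDeriv d c 0 y = Complex.exp (c * y ^ d) := by
  simp [expPowDeriv, expPowPoly]

theorem hasDerivAt_expPowDeriv (d : ℕ) (c : ℂ) (j : ℕ) (y : ℝ) :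
    HasDerivAt (expPowDeriv d c j) (expPowDeriv d c (j + 1) y) y := by
  have h1 : HasDerivAt (fun z : ℂ => (expPowPoly d c j).eval z * Complex.exp (c * z ^ d))
      (expPowDeriv d c (j + 1) y) (y : ℂ) := by
    have h2 := ((expPowPoly d c j).hasDerivAt (y : ℂ)).mul
      ((hasDerivAt_pow d (y : ℂ)).const_mul c).cexp
    refine h2.congr_deriv ?_
    simp [expPowDeriv, expPowPoly]
    ring
  exact h1.comp_ofReal

open MeasureTheory in
theorem integrableOn_expPowDeriv {d : ℕ} (hd : 1 ≤ d) {c : ℂ} (hc : c.re < 0) (j : ℕ) :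
    IntegrableOn (expPowDeriv d c j) (Set.Ioi 0) := by
  have hcont : ∀ j, Continuous (expPowDeriv d c j) := fun j =>
    continuous_iff_continuousAt.2 fun x => (hasDerivAt_expPowDeriv d c j x).continuousAt
  have hmono : ∀ k : ℕ, IntegrableOn (fun y : ℝ => ((y : ℂ)) ^ k * Complex.exp (c * y ^ d))
      (Set.Ioi 0) := by
    intro k
    have h1 := integrableOn_rpow_mul_exp_neg_mul_rpow (s := k) (p := d) (b := -c.re)
      (by have : (0 : ℝ) ≤ k := by positivity
          linarith) (by exact_mod_cast hd) (by linarith)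
    refine Integrable.mono' h1 (Continuous.aestronglyMeasurable (by fun_prop)) ?_
    refine (ae_restrict_iff' measurableSet_Ioi).2 (Eventually.of_forall fun y hy => le_of_eq ?_)
    have hy : 0 < y := hy
    rw [norm_mul, norm_pow, Complex.norm_real, Real.norm_of_nonneg hy.le, Complex.norm_exp,
      Real.rpow_natCast, Real.rpow_natCast, neg_neg, ← Complex.ofReal_pow, Complex.re_mul_ofReal]
  have : expPowDeriv d c j = fun y : ℝ => ∑ k ∈ Finset.range ((expPowPoly d c j).natDegree + 1),
      (expPowPoly d c j).coeff k * ((y : ℂ) ^ k * Complex.exp (c * y ^ d)) := by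
    ext y
    rw [expPowDeriv, Polynomial.eval_eq_sum_range, Finset.sum_mul]
    exact Finset.sum_congr rfl fun k _ => by ring
  rw [this]
  exact integrable_finsetSum _ fun k _ => (hmono k).const_mul _

/-- These are j! times the Taylor coefficients of exp(c y^d) at 0. The formal series E = Σ c^k
X^(dk)/k! satisfies E' = c d X^(d-1) E, so its j-th derivative is P_j E, and E has constant term 1.
-/
theorem expPowPoly_eval_zero {d : ℕ} (hd : 1 ≤ d) (c : ℂ) (j : ℕ) :
    (expPowPoly d c j).eval 0
      = if d ∣ j then (j.factorial : ℂ) * (c ^ (j / d) / (j / d).factorial) else 0 := by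
  let E : PowerSeries ℂ := PowerSeries.mk fun n =>
    if d ∣ n then c ^ (n / d) / ((n / d).factorial : ℂ) else 0
  have hE : PowerSeries.derivative ℂ E
      = PowerSeries.C (c * d) * PowerSeries.X ^ (d - 1) * E := by
    ext n
    rw [PowerSeries.coeff_derivative, mul_assoc, PowerSeries.coeff_C_mul,
      PowerSeries.coeff_X_pow_mul']
    simp only [E, PowerSeries.coeff_mk]
    by_cases h : d ∣ n + 1
    · obtain ⟨m, hm⟩ := h
      have hm0 : m ≠ 0 := by rintro rfl; simp at hm
      obtain ⟨m, rfl⟩ := Nat.exists_eq_succ_of_ne_zero hm0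
      have h1 : d - 1 ≤ n := by
        have := Nat.le_mul_of_pos_right d (Nat.succ_pos m)
        omega
      have h2 : n - (d - 1) = d * m := by
        have : d * m.succ = d * m + d := by rw [Nat.mul_succ]
        omega
      have hdm : d * m.succ / d = m + 1 := Nat.mul_div_cancel_left _ (by omega)
      have hdm' : d * m / d = m := Nat.mul_div_cancel_left _ (by omega)
      rw [if_pos h1, h2, hm, if_pos (dvd_mul_right _ _), if_pos (dvd_mul_right _ _), hdm, hdm',
        Nat.factorial_succ]
      have hn : (n + 1 : ℂ) = d * (m + 1) := by exact_mod_cast hm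
      have h3 : (m.factorial : ℂ) ≠ 0 := by exact_mod_cast m.factorial_ne_zero
      have h4 : (m + 1 : ℂ) ≠ 0 := by exact_mod_cast m.succ_ne_zero
      rw [hn]
      push_cast
      field_simp
      ring
    · rw [if_neg h, zero_mul]
      split_ifs with h1 h2
      · exfalso
        apply h
        have : n + 1 = n - (d - 1) + d := by omega
        rw [this]
        exact dvd_add h2 dvd_rfl
      · simp
      · simp
  have hiter : ∀ j, (PowerSeries.derivative ℂ)^[j] E = (expPowPoly d c j : PowerSeries ℂ) * E := by
    intro j
    induction j with
    | zero => simp [expPowPoly]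
    | succ j ih =>
      rw [Function.iterate_succ_apply', ih, Derivation.leibniz, hE]
      simp only [smul_eq_mul, expPowPoly, Polynomial.coe_add, Polynomial.coe_mul,
        Polynomial.coe_pow, Polynomial.coe_C, Polynomial.coe_X, PowerSeries.derivative_coe]
      ring
  have h := PowerSeries.constantCoeff_iterate_derivative E j
  rw [hiter] at h
  have hE0 : PowerSeries.constantCoeff E = 1 := by
    rw [← PowerSeries.coeff_zero_eq_constantCoeff_apply]
    simp [E]
  rw [map_mul, hE0, mul_one, Polynomial.constantCoeff_coe, Polynomial.coeff_zero_eq_eval_zero,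
    PowerSeries.coeff_mk] at h
  rw [h]
  split_ifs <;> simp

/-! ### The theta series and its expansion at t = 0 -/

/-- `∑_{m ≥ 1} exp (-γ t m^d)`. -/
noncomputable def powTheta (d : ℕ) (γ : ℂ) (t : ℝ) : ℂ :=
  ∑' m : ℕ, Complex.exp (-(γ * t * (m + 1) ^ d))

/-- `∫_0^∞ exp (-γ y^d) dy`. -/
noncomputable def powThetaConst (d : ℕ) (γ : ℂ) : ℂ :=
  ∫ y in Set.Ioi (0 : ℝ), Complex.exp (-γ * y ^ d)

/-- The coefficients `ζ(-dk) (-γ)^k / k!` in the small `t` expansion of `powTheta d γ t`. -/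
noncomputable def powThetaCoeff (d : ℕ) (γ : ℂ) (k : ℕ) : ℂ :=
  riemannZeta (-(d * k : ℕ)) * ((-γ) ^ k / k.factorial)

/-- The remainder in the small `t` expansion of `powTheta d γ t`. -/
noncomputable def powThetaRem (d : ℕ) (γ : ℂ) (K : ℕ) (t : ℝ) : ℂ :=
  powTheta d γ t - powThetaConst d γ * (t : ℂ) ^ (-(1 / d) : ℂ)
    - ∑ k ∈ Finset.range K, powThetaCoeff d γ k * (t : ℂ) ^ k

theorem norm_exp_powTheta_le {d : ℕ} (hd : 1 ≤ d) {γ : ℂ} (hγ : 0 < γ.re) {a t : ℝ} (ha : 0 ≤ a)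
    (hat : a ≤ t) (m : ℕ) :
    ‖Complex.exp (-(γ * t * (m + 1) ^ d))‖ ≤ Real.exp (-(γ.re * a)) ^ (m + 1) := by
  rw [Complex.norm_exp, ← Real.exp_nat_mul, Real.exp_le_exp]
  have h1 : (-(γ * t * (m + 1) ^ d) : ℂ).re = -(γ.re * t * (m + 1) ^ d) := by
    have : (γ * t * (m + 1) ^ d : ℂ) = γ * ((t * (m + 1) ^ d : ℝ) : ℂ) := by push_cast; ring
    rw [Complex.neg_re, this, Complex.re_mul_ofReal]
    ring
  rw [h1]
  have h2 : (m + 1 : ℝ) ≤ (m + 1) ^ d := le_self_pow₀ (by linarith [m.cast_nonneg (α := ℝ)])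
    (by omega)
  push_cast
  have h3 : γ.re * a * (m + 1 : ℝ) ≤ γ.re * t * (m + 1) ^ d := by
    gcongr
    exact mul_nonneg hγ.le (ha.trans hat)
  linarith

theorem summable_exp_powTheta {d : ℕ} (hd : 1 ≤ d) {γ : ℂ} (hγ : 0 < γ.re) {t : ℝ} (ht : 0 < t) :
    Summable fun m : ℕ => Complex.exp (-(γ * t * (m + 1) ^ d)) := by
  refine Summable.of_norm_bounded ?_ (norm_exp_powTheta_le hd hγ ht.le le_rfl)
  rw [summable_nat_add_iff (f := fun m => Real.exp (-(γ.re * t)) ^ m)]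
  exact summable_geometric_of_lt_one (Real.exp_pos _).le
    (Real.exp_lt_one_iff.2 (by have := mul_pos hγ ht; linarith))

theorem continuousOn_powTheta {d : ℕ} (hd : 1 ≤ d) {γ : ℂ} (hγ : 0 < γ.re) :
    ContinuousOn (powTheta d γ) (Set.Ioi 0) := by
  intro t ht
  have ht : 0 < t := ht
  have h1 : ContinuousOn (powTheta d γ) (Set.Ici (t / 2)) := by
    refine continuousOn_tsum (u := fun m => Real.exp (-(γ.re * (t / 2))) ^ (m + 1))
      (fun m => Continuous.continuousOn (by fun_prop)) ?_
      fun m x hx => norm_exp_powTheta_le hd hγ (by positivity) hx m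
    rw [summable_nat_add_iff (f := fun m => Real.exp (-(γ.re * (t / 2))) ^ m)]
    exact summable_geometric_of_lt_one (Real.exp_pos _).le
      (Real.exp_lt_one_iff.2 (by have := mul_pos hγ (half_pos ht); linarith))
  exact (h1.continuousAt (Ici_mem_nhds (by linarith))).continuousWithinAt

theorem continuousOn_powThetaRem {d : ℕ} (hd : 1 ≤ d) {γ : ℂ} (hγ : 0 < γ.re) (K : ℕ) :
    ContinuousOn (powThetaRem d γ K) (Set.Ioi 0) := by
  refine ((continuousOn_powTheta hd hγ).sub (continuousOn_const.mul ?_)).sub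
    (Continuous.continuousOn (by fun_prop))
  refine ContinuousOn.cpow_const Complex.continuous_ofReal.continuousOn fun t ht => ?_
  exact Complex.ofReal_mem_slitPlane.2 ht

/-- Scaled Euler–Maclaurin for exp(-γ y^d) with mesh h = t^(1/d) and order J = dK, so that h^J =
t^K. Only the derivatives of order divisible by d survive at 0. The bound holds for all t > 0, not
only near 0, so it can be integrated over the half-line. -/
theorem exists_norm_powThetaRem_le {d : ℕ} (hd : 1 ≤ d) {γ : ℂ} (hγ : 0 < γ.re) (K : ℕ) :
    ∃ C : ℝ, 0 ≤ C ∧ ∀ t : ℝ, 0 < t → ‖powThetaRem d γ K t‖ ≤ C * t ^ K := by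
  have hγ' : (-γ).re < 0 := by simpa using hγ
  have hd0 : (d : ℝ) ≠ 0 := by positivity
  have hexp : ∀ (h : ℝ) (m : ℕ), expPowDeriv d (-γ) 0 (h * (m + 1))
      = Complex.exp (-(γ * (h ^ d : ℝ) * (m + 1) ^ d)) := by
    intro h m
    rw [expPowDeriv_zero]
    push_cast
    rw [mul_pow]
    congr 1
    ring
  obtain ⟨C, hC0, hC⟩ := exists_norm_tsum_scaled_sub_le (d * K)
    (hasDerivAt_expPowDeriv d (-γ)) (integrableOn_expPowDeriv hd hγ') (fun h hh => by
      simp only [hexp]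
      exact summable_exp_powTheta hd hγ (pow_pos hh d))
  have hsum : ∀ (h : ℝ), ∑ j ∈ Finset.range (d * K + 1), riemannZeta (-j) / j.factorial
        * ((h : ℂ) ^ j * expPowDeriv d (-γ) j 0)
      = ∑ k ∈ Finset.range (K + 1), powThetaCoeff d γ k * ((h ^ d : ℝ) : ℂ) ^ k := by
    intro h
    have hinj : Set.InjOn (fun k => d * k) (Finset.range (K + 1) : Set ℕ) := fun a _ b _ hab =>
      Nat.eq_of_mul_eq_mul_left (by omega) hab
    have himg : (Finset.range (K + 1)).image (fun k => d * k) ⊆ Finset.range (d * K + 1) := by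
      intro j hj
      obtain ⟨k, hk, rfl⟩ := Finset.mem_image.1 hj
      have : d * k ≤ d * K := Nat.mul_le_mul_left _ (by simpa [Nat.lt_succ_iff] using hk)
      exact Finset.mem_range.2 (by omega)
    rw [← Finset.sum_subset himg, Finset.sum_image hinj]
    · refine Finset.sum_congr rfl fun k _ => ?_
      have h1 : ((d * k).factorial : ℂ) ≠ 0 := by exact_mod_cast (d * k).factorial_ne_zero
      rw [expPowDeriv, Complex.ofReal_zero, expPowPoly_eval_zero hd, if_pos (dvd_mul_right _ _),
        Nat.mul_div_cancel_left _ (by omega), zero_pow (by omega), mul_zero, Complex.exp_zero,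
        powThetaCoeff]
      push_cast
      rw [← pow_mul]
      field_simp
    · intro j hj hj'
      have : ¬ d ∣ j := by
        rintro ⟨k, rfl⟩
        apply hj'
        refine Finset.mem_image.2 ⟨k, ?_, rfl⟩
        have h1 : d * k ≤ d * K := by have := Finset.mem_range.1 hj; omega
        have := Nat.le_of_mul_le_mul_left h1 (by omega)
        exact Finset.mem_range.2 (by omega)
      rw [expPowDeriv, Complex.ofReal_zero, expPowPoly_eval_zero hd, if_neg this]
      simp
  -- Euler–Maclaurin subtracts the terms k ≤ K, `powThetaRem` only those with k < K; the extra term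
  -- is a multiple of t^K and goes into the constant.
  refine ⟨C + ‖powThetaCoeff d γ K‖, by positivity, fun t ht => ?_⟩
  have hh : 0 < t ^ (1 / d : ℝ) := Real.rpow_pos_of_pos ht _
  have hhd : (t ^ (1 / d : ℝ)) ^ d = t := by
    rw [← Real.rpow_natCast, ← Real.rpow_mul ht.le, one_div, inv_mul_cancel₀ hd0, Real.rpow_one]
  have hinv : ((t ^ (1 / d : ℝ) : ℝ) : ℂ)⁻¹ = (t : ℂ) ^ (-(1 / d) : ℂ) := by
    rw [Complex.cpow_neg, Complex.ofReal_cpow ht.le]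
    push_cast
    rfl
  have h1 := hC _ hh
  rw [hsum] at h1
  simp only [hexp, hhd, hinv] at h1
  have h2 : (t ^ (1 / d : ℝ)) ^ (d * K) = t ^ K := by rw [pow_mul, hhd]
  rw [h2] at h1
  have h3 : ∫ x in Set.Ioi (0 : ℝ), expPowDeriv d (-γ) 0 x = powThetaConst d γ := by
    simp only [expPowDeriv_zero, powThetaConst]
  rw [h3, Finset.sum_range_succ] at h1
  have h4 : powThetaRem d γ K t = (powTheta d γ t - (t : ℂ) ^ (-(1 / d) : ℂ) * powThetaConst d γ
      - (∑ k ∈ Finset.range K, powThetaCoeff d γ k * (t : ℂ) ^ k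
        + powThetaCoeff d γ K * (t : ℂ) ^ K)) + powThetaCoeff d γ K * (t : ℂ) ^ K := by
    rw [powThetaRem]; ring
  rw [h4, add_mul]
  refine (norm_add_le _ _).trans (add_le_add h1 (le_of_eq ?_))
  rw [norm_mul, norm_pow, Complex.norm_real, Real.norm_of_nonneg ht.le]

/-! ### Gamma integrals with complex scaling -/

theorem norm_cpow_mul_exp_neg {a r : ℂ} {t : ℝ} (ht : 0 < t) :
    ‖(t : ℂ) ^ (a - 1) * Complex.exp (-(r * t))‖
      = t ^ (a.re - 1) * Real.exp (-(r.re * t)) := by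
  rw [norm_mul, Complex.norm_cpow_eq_rpow_re_of_pos ht, Complex.norm_exp]
  simp

open MeasureTheory in
theorem integrableOn_rpow_mul_exp_neg {a r : ℝ} (ha : 0 < a) (hr : 0 < r) :
    IntegrableOn (fun t : ℝ => t ^ (a - 1) * Real.exp (-(r * t))) (Set.Ioi 0) := by
  have := integrableOn_rpow_mul_exp_neg_mul_rpow (s := a - 1) (p := 1) (b := r) (by linarith)
    one_pos hr
  simpa using this

open MeasureTheory in
theorem integrableOn_cpow_mul_exp_neg {a r : ℂ} (ha : 0 < a.re) (hr : 0 < r.re) :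
    IntegrableOn (fun t : ℝ => (t : ℂ) ^ (a - 1) * Complex.exp (-(r * t))) (Set.Ioi 0) := by
  refine Integrable.mono' (integrableOn_rpow_mul_exp_neg ha hr) ?_
    ((ae_restrict_iff' measurableSet_Ioi).2 (Eventually.of_forall fun t ht =>
      (norm_cpow_mul_exp_neg ht).le))
  refine ContinuousOn.aestronglyMeasurable (ContinuousOn.mul ?_
    (Continuous.continuousOn (by fun_prop))) measurableSet_Ioi
  exact Complex.continuous_ofReal.continuousOn.cpow_const fun t ht =>
    Complex.ofReal_mem_slitPlane.2 ht

open MeasureTheory in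
theorem integral_norm_cpow_mul_exp_neg {a r : ℂ} (ha : 0 < a.re) (hr : 0 < r.re) :
    ∫ t in Set.Ioi (0 : ℝ), ‖(t : ℂ) ^ (a - 1) * Complex.exp (-(r * t))‖
      = r.re ^ (-a.re) * Real.Gamma a.re := by
  rw [setIntegral_congr_fun measurableSet_Ioi fun t ht => norm_cpow_mul_exp_neg ht,
    Real.integral_rpow_mul_exp_neg_mul_Ioi ha hr, one_div, Real.inv_rpow hr.le,
    Real.rpow_neg hr.le]

open MeasureTheory in
/-- The Gamma integral with a complex scaling of positive real part. -/
theorem integral_cpow_mul_exp_neg_of_re_pos {a r : ℂ} (ha : 0 < a.re) (hr : 0 < r.re) :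
    ∫ t in Set.Ioi (0 : ℝ), (t : ℂ) ^ (a - 1) * Complex.exp (-(r * t))
      = r ^ (-a) * Complex.Gamma a := by
  let U : Set ℂ := {z | 0 < z.re}
  have hU : IsOpen U := isOpen_lt continuous_const Complex.continuous_re
  have hUc : IsPreconnected U := (convex_halfSpace_re_gt 0).isPreconnected
  have hF : DifferentiableOn ℂ
      (fun r => ∫ t in Set.Ioi (0 : ℝ), (t : ℂ) ^ (a - 1) * Complex.exp (-(r * t))) U := by
    intro r hr
    have hr : 0 < r.re := hr
    have hmem : {z : ℂ | r.re / 2 < z.re} ∈ 𝓝 r :=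
      (isOpen_lt continuous_const Complex.continuous_re).mem_nhds (by simpa using hr)
    have ha1 : 0 < (a + 1).re := by simp; linarith
    refine (hasDerivAt_integral_of_dominated_loc_of_deriv_le
      (F := fun r (t : ℝ) => (t : ℂ) ^ (a - 1) * Complex.exp (-(r * t)))
      (F' := fun r (t : ℝ) => -((t : ℂ) ^ ((a + 1) - 1) * Complex.exp (-(r * t))))
      (bound := fun t => t ^ ((a + 1).re - 1) * Real.exp (-(r.re / 2 * t)))
      hmem ?_ (integrableOn_cpow_mul_exp_neg ha hr)
      (integrableOn_cpow_mul_exp_neg ha1 hr).neg.aestronglyMeasurable ?_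
      (integrableOn_rpow_mul_exp_neg ha1 (half_pos hr)) ?_).2.differentiableAt.differentiableWithinAt
    · filter_upwards [hU.mem_nhds hr] with z hz
      exact (integrableOn_cpow_mul_exp_neg ha hz).aestronglyMeasurable
    · refine (ae_restrict_iff' measurableSet_Ioi).2 (Eventually.of_forall fun t ht z hz => ?_)
      have ht : 0 < t := ht
      have hz : r.re / 2 < z.re := hz
      rw [norm_neg, norm_cpow_mul_exp_neg ht]
      gcongr
    · refine (ae_restrict_iff' measurableSet_Ioi).2 (Eventually.of_forall fun t ht z hz => ?_)
      have ht0 : (t : ℂ) ≠ 0 := Complex.ofReal_ne_zero.2 (ne_of_gt ht)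
      have h1 : HasDerivAt (fun z : ℂ => (t : ℂ) ^ (a - 1) * Complex.exp (-(z * t)))
          ((t : ℂ) ^ (a - 1) * (Complex.exp (-(z * t)) * -(1 * t))) z :=
        (((hasDerivAt_id z).mul_const (t : ℂ)).neg.cexp).const_mul _
      refine h1.congr_deriv ?_
      have h2 : (t : ℂ) ^ ((a + 1) - 1) = (t : ℂ) ^ (a - 1) * t := by
        rw [show a + 1 - 1 = (a - 1) + 1 by ring, Complex.cpow_add _ _ ht0, Complex.cpow_one]
      rw [h2]
      ring
  have hG : DifferentiableOn ℂ (fun r : ℂ => r ^ (-a) * Complex.Gamma a) U := by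
    refine DifferentiableOn.mul_const (fun r hr => ?_) _
    exact (differentiableAt_id.cpow_const (Or.inl hr)).differentiableWithinAt
  -- Both sides are holomorphic in r on the right half-plane and agree for real r > 0; the points 1
  -- + 1/(n+1) accumulate at 1, so the identity theorem applies.
  refine (hF.analyticOnNhd hU).eqOn_of_preconnected_of_frequently_eq (hG.analyticOnNhd hU) hUc
    (z₀ := 1) (by simp [U]) ?_ hr
  have hseq : Tendsto (fun n : ℕ => ((1 + 1 / ((n : ℝ) + 1) : ℝ) : ℂ)) atTop (𝓝[≠] 1) := by
    refine tendsto_nhdsWithin_iff.2 ⟨?_, Eventually.of_forall fun n => ?_⟩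
    · have h1 := (tendsto_one_div_add_atTop_nhds_zero_nat (𝕜 := ℝ)).const_add 1
      rw [add_zero] at h1
      have h2 := (Complex.continuous_ofReal.tendsto 1).comp h1
      rw [Complex.ofReal_one] at h2
      exact h2
    · have : (1 / ((n : ℝ) + 1)) ≠ 0 := by positivity
      rw [Set.mem_compl_iff, Set.mem_singleton_iff]
      intro h
      have h2 : (1 + 1 / ((n : ℝ) + 1) : ℝ) = 1 := by exact_mod_cast h
      exact this (by linarith)
  refine hseq.frequently (Frequently.of_forall fun n => ?_)
  have hpos : (0 : ℝ) < 1 + 1 / ((n : ℝ) + 1) := by positivity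
  rw [Complex.integral_cpow_mul_exp_neg_mul_Ioi ha hpos, one_div,
    Complex.inv_cpow _ _ (by rw [Complex.arg_ofReal_of_nonneg hpos.le]; exact Real.pi_pos.ne),
    Complex.cpow_neg]

/-! ### Expansion of the sum over a single variable -/

/-- The remainder in the expansion of `∑_{m ≥ 1} (A + γ m^d)^(-s)`. -/
noncomputable def powSumRem (d : ℕ) (γ : ℂ) (K : ℕ) (A s : ℂ) : ℂ :=
  (Complex.Gamma s)⁻¹ * mellin (fun t => Complex.exp (-(A * t)) * powThetaRem d γ K t) s

/-- The zeros of 1/Γ: this is why no remainder enters the special values. The convention Γ(-N) = 0,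
0⁻¹ = 0 gives 1/Γ its correct value there. -/
theorem powSumRem_neg_nat (d : ℕ) (γ : ℂ) (K : ℕ) (A : ℂ) (N : ℕ) :
    powSumRem d γ K A (-N) = 0 := by
  rw [powSumRem, Complex.Gamma_neg_nat_eq_zero, inv_zero, zero_mul]

open MeasureTheory in
theorem integrableOn_powSumRem {d : ℕ} (hd : 1 ≤ d) {γ : ℂ} (hγ : 0 < γ.re) (K : ℕ) {A s : ℂ}
    (hA : 0 < A.re) (hs : -(K : ℝ) < s.re) :
    IntegrableOn (fun t : ℝ => (t : ℂ) ^ (s - 1)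
      * (Complex.exp (-(A * t)) * powThetaRem d γ K t)) (Set.Ioi 0) := by
  obtain ⟨C, hC0, hC⟩ := exists_norm_powThetaRem_le hd hγ K
  have hsK : 0 < (s + K).re := by simp; linarith
  refine Integrable.mono' ((integrableOn_cpow_mul_exp_neg hsK hA).norm.const_mul C) ?_ ?_
  · refine ContinuousOn.aestronglyMeasurable (ContinuousOn.mul ?_
      (ContinuousOn.mul (Continuous.continuousOn (by fun_prop)) (continuousOn_powThetaRem hd hγ K)))
      measurableSet_Ioi
    exact Complex.continuous_ofReal.continuousOn.cpow_const fun t ht =>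
      Complex.ofReal_mem_slitPlane.2 ht
  · refine (ae_restrict_iff' measurableSet_Ioi).2 (Eventually.of_forall fun t ht => ?_)
    have ht : 0 < t := ht
    rw [norm_cpow_mul_exp_neg ht, ← mul_assoc, norm_mul, norm_cpow_mul_exp_neg ht]
    have h1 : t ^ ((s + K).re - 1) = t ^ (s.re - 1) * t ^ K := by
      rw [← Real.rpow_natCast, ← Real.rpow_add ht]
      congr 1
      simp
      ring
    calc _ ≤ t ^ (s.re - 1) * Real.exp (-(A.re * t)) * (C * t ^ K) := by
          gcongr
          exact hC t ht
      _ = _ := by rw [h1]; ring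

-- Inserting the bound C t^K leaves a real Gamma integral, equal to Γ(Re s + K) (Re A)^(-(Re s +
-- K)). Continuity of the factor in s allows locally uniform estimates when A is later summed over.
open MeasureTheory in
theorem exists_norm_powSumRem_le {d : ℕ} (hd : 1 ≤ d) {γ : ℂ} (hγ : 0 < γ.re) (K : ℕ) :
    ∃ M : ℂ → ℝ, ContinuousOn M {s | -(K : ℝ) < s.re} ∧ ∀ A s : ℂ, 0 < A.re → -(K : ℝ) < s.re →
      ‖powSumRem d γ K A s‖ ≤ M s * A.re ^ (-(s.re + K)) := by
  obtain ⟨C, hC0, hC⟩ := exists_norm_powThetaRem_le hd hγ K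
  refine ⟨fun s => ‖(Complex.Gamma s)⁻¹‖ * (C * Real.Gamma (s.re + K)), ?_, fun A s hA hs => ?_⟩
  · refine ContinuousOn.mul Complex.differentiable_one_div_Gamma.continuous.norm.continuousOn
      (continuousOn_const.mul fun s hs => ContinuousAt.continuousWithinAt ?_)
    have hs : -(K : ℝ) < s.re := hs
    refine ContinuousAt.comp (f := fun s : ℂ => s.re + K) (g := Real.Gamma)
      (Real.differentiableAt_Gamma fun m => ?_).continuousAt
      (by fun_prop)
    have : (0 : ℝ) ≤ m := m.cast_nonneg
    intro h
    linarith
  · have hsK : 0 < (s + K).re := by simp; linarith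
    rw [powSumRem, norm_mul, mul_assoc]
    refine mul_le_mul_of_nonneg_left ?_ (norm_nonneg _)
    have h2 := integral_norm_cpow_mul_exp_neg hsK hA
    calc _ ≤ ∫ t in Set.Ioi (0 : ℝ),
          C * ‖(t : ℂ) ^ ((s + K) - 1) * Complex.exp (-(A * t))‖ := by
          refine norm_integral_le_of_norm_le
            ((integrableOn_cpow_mul_exp_neg hsK hA).norm.const_mul C)
            ((ae_restrict_iff' measurableSet_Ioi).2 (Eventually.of_forall fun t ht => ?_))
          have ht : 0 < t := ht
          rw [norm_cpow_mul_exp_neg ht, smul_eq_mul, ← mul_assoc, norm_mul,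
            norm_cpow_mul_exp_neg ht]
          have h1 : t ^ ((s + K).re - 1) = t ^ (s.re - 1) * t ^ K := by
            rw [← Real.rpow_natCast, ← Real.rpow_add ht]
            congr 1
            simp
            ring
          calc _ ≤ t ^ (s.re - 1) * Real.exp (-(A.re * t)) * (C * t ^ K) := by
                gcongr
                exact hC t ht
            _ = _ := by rw [h1]; ring
      _ = _ := by
          rw [integral_const_mul, h2]
          simp
          ring

open MeasureTheory in
theorem differentiableAt_powSumRem {d : ℕ} (hd : 1 ≤ d) {γ : ℂ} (hγ : 0 < γ.re) (K : ℕ) {A s : ℂ}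
    (hA : 0 < A.re) (hs : -(K : ℝ) < s.re) : DifferentiableAt ℂ (powSumRem d γ K A) s := by
  obtain ⟨C, hC0, hC⟩ := exists_norm_powThetaRem_le hd hγ K
  refine (Complex.differentiable_one_div_Gamma s).mul ?_
  have hcont : ContinuousOn (fun t : ℝ => Complex.exp (-(A * t)) * powThetaRem d γ K t)
      (Set.Ioi 0) :=
    ContinuousOn.mul (Continuous.continuousOn (by fun_prop)) (continuousOn_powThetaRem hd hγ K)
  have hnorm : ∀ t : ℝ, 0 < t → ‖Complex.exp (-(A * t)) * powThetaRem d γ K t‖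
      ≤ C * (Real.exp (-(A.re * t)) * t ^ K) := by
    intro t ht
    rw [norm_mul, Complex.norm_exp]
    calc _ ≤ Real.exp (-(A.re * t)) * (C * t ^ K) := by
          simp only [Complex.neg_re, Complex.re_mul_ofReal]
          gcongr
          exact hC t ht
      _ = _ := by ring
  refine mellin_differentiableAt_of_isBigO_rpow_exp (a := A.re / 2) (b := -K) (half_pos hA)
    (hcont.locallyIntegrableOn measurableSet_Ioi) ?_ ?_ hs
  -- Half of the exponential decay is spent on absorbing t^K.
  · have h1 : (fun t : ℝ => Real.exp (-(A.re * t)) * t ^ K) =O[atTop]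
        fun t => Real.exp (-(A.re / 2) * t) := by
      have h2 := (isLittleO_pow_exp_pos_mul_atTop K (half_pos hA)).isBigO
      have h3 := (Asymptotics.isBigO_refl (fun t : ℝ => Real.exp (-(A.re * t))) atTop).mul h2
      refine h3.congr_right fun t => ?_
      rw [← Real.exp_add]
      congr 1
      ring
    refine Asymptotics.IsBigO.trans ?_ h1
    refine Asymptotics.IsBigO.of_bound C ?_
    filter_upwards [eventually_gt_atTop 0] with t ht
    rw [Real.norm_of_nonneg (by positivity)]
    exact hnorm t ht
  · refine Asymptotics.IsBigO.of_bound C ?_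
    filter_upwards [self_mem_nhdsWithin] with t ht
    have ht : 0 < t := ht
    refine (hnorm t ht).trans ?_
    rw [neg_neg, Real.rpow_natCast, Real.norm_of_nonneg (by positivity)]
    gcongr
    refine mul_le_of_le_one_left (by positivity) (Real.exp_le_one_iff.2 ?_)
    have := mul_pos hA ht
    linarith

theorem Complex.Gamma_add_natCast {s : ℂ} (hs : 0 < s.re) (k : ℕ) :
    Complex.Gamma (s + k) = (∏ i ∈ Finset.range k, (s + i)) * Complex.Gamma s := by
  induction k with
  | zero => simp
  | succ k ih =>
    have h : s + k ≠ 0 := by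
      intro h
      have := congrArg Complex.re h
      simp at this
      linarith [k.cast_nonneg (α := ℝ)]
    rw [Nat.cast_succ, ← add_assoc, Complex.Gamma_add_one _ h, ih, Finset.prod_range_succ]
    ring

theorem summable_rpow_add_mul_pow {d : ℕ} (hd : 1 ≤ d) {a b σ : ℝ} (ha : 0 ≤ a) (hb : 0 < b)
    (hσ : 1 / (d : ℝ) < σ) : Summable fun m : ℕ => (a + b * (m + 1) ^ d) ^ (-σ) := by
  have hd0 : (0 : ℝ) < d := by positivity
  have hσ0 : 0 < σ := lt_trans (by positivity) hσ
  have h1 : Summable fun m : ℕ => b ^ (-σ) * ((m + 1 : ℕ) : ℝ) ^ (-(d * σ)) := by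
    refine Summable.mul_left _ ?_
    rw [summable_nat_add_iff (f := fun m : ℕ => (m : ℝ) ^ (-(d * σ))) 1, Real.summable_nat_rpow]
    rw [div_lt_iff₀ hd0] at hσ
    linarith
  refine Summable.of_nonneg_of_le (fun m => by positivity) (fun m => ?_) h1
  have h2 : b ^ (-σ) * ((m + 1 : ℕ) : ℝ) ^ (-(d * σ)) = (b * (m + 1) ^ d) ^ (-σ) := by
    rw [Real.mul_rpow hb.le (by positivity), ← Real.rpow_natCast, ← Real.rpow_mul (by positivity)]
    push_cast
    ring_nf
  rw [h2]
  exact Real.rpow_le_rpow_of_nonpos (by positivity) (by linarith) (by linarith)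

theorem re_add_mul_natCast_pow (A γ : ℂ) (m d : ℕ) :
    (A + γ * ((m : ℂ) + 1) ^ d).re = A.re + γ.re * ((m : ℝ) + 1) ^ d := by
  have : γ * ((m : ℂ) + 1) ^ d = γ * (((m + 1) ^ d : ℝ) : ℂ) := by push_cast; rfl
  rw [this, Complex.add_re, Complex.re_mul_ofReal]

open MeasureTheory in
/-- The expansion of `∑_{m ≥ 1} (A + γ m^d)^(-s)` in powers of `A`. -/
theorem hasSum_cpow_add_mul_pow {d : ℕ} (hd : 1 ≤ d) {γ : ℂ} (hγ : 0 < γ.re) (K : ℕ) {A s : ℂ}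
    (hA : 0 < A.re) (hs : 1 / (d : ℝ) < s.re) :
    HasSum (fun m : ℕ => (A + γ * ((m : ℂ) + 1) ^ d) ^ (-s))
      (powThetaConst d γ * (Complex.Gamma (s - 1 / d) * (Complex.Gamma s)⁻¹) * A ^ (-(s - 1 / d))
        + ∑ k ∈ Finset.range K,
            powThetaCoeff d γ k * (∏ i ∈ Finset.range k, (s + i)) * A ^ (-(s + k))
        + powSumRem d γ K A s) := by
  have hs0 : 0 < s.re := lt_trans (by positivity) hs
  have hre : ∀ m : ℕ, 0 < (A + γ * ((m : ℂ) + 1) ^ d).re := fun m => by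
    rw [re_add_mul_natCast_pow]; positivity
  have hG : Complex.Gamma s ≠ 0 := Complex.Gamma_ne_zero_of_re_pos hs0
  have hsd : 0 < (s - 1 / d).re := by
    have : (1 / d : ℂ) = ((1 / d : ℝ) : ℂ) := by push_cast; rfl
    rw [Complex.sub_re, this, Complex.ofReal_re]
    linarith
  -- Each summand is Γ(s)⁻¹ times a Gamma integral. Sum and integral may be exchanged because the
  -- integrals of the norms are multiples of (Re A + Re γ (m+1)^d)^(-Re s), summable for Re s > 1/d.
  have h1 := hasSum_integral_of_summable_integral_norm (μ := volume.restrict (Set.Ioi (0 : ℝ)))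
    (F := fun (m : ℕ) (t : ℝ) => (t : ℂ) ^ (s - 1)
      * Complex.exp (-((A + γ * ((m : ℂ) + 1) ^ d) * t)))
    (fun m => integrableOn_cpow_mul_exp_neg hs0 (hre m)) (by
      simp only [integral_norm_cpow_mul_exp_neg hs0 (hre _), re_add_mul_natCast_pow]
      exact (summable_rpow_add_mul_pow hd hA.le hγ hs).mul_right _)
  simp only [integral_cpow_mul_exp_neg_of_re_pos hs0 (hre _)] at h1
  have hcpow : ∀ t : ℝ, 0 < t → ∀ w v : ℂ, (t : ℂ) ^ (w + v) = (t : ℂ) ^ w * (t : ℂ) ^ v :=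
    fun t ht w v => Complex.cpow_add _ _ (Complex.ofReal_ne_zero.2 ht.ne')
  have h2 : ∫ t in Set.Ioi (0 : ℝ), ∑' m : ℕ, (t : ℂ) ^ (s - 1)
      * Complex.exp (-((A + γ * ((m : ℂ) + 1) ^ d) * t))
      = ∫ t in Set.Ioi (0 : ℝ), ((powThetaConst d γ
            * ((t : ℂ) ^ (s - 1 / d - 1) * Complex.exp (-(A * t)))
          + ∑ k ∈ Finset.range K, powThetaCoeff d γ k
            * ((t : ℂ) ^ (s + k - 1) * Complex.exp (-(A * t))))
          + (t : ℂ) ^ (s - 1) * (Complex.exp (-(A * t)) * powThetaRem d γ K t)) := by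
    refine setIntegral_congr_fun measurableSet_Ioi fun t ht => ?_
    have ht : 0 < t := ht
    have h3 : ∀ m : ℕ, (t : ℂ) ^ (s - 1) * Complex.exp (-((A + γ * ((m : ℂ) + 1) ^ d) * t))
        = ((t : ℂ) ^ (s - 1) * Complex.exp (-(A * t)))
          * Complex.exp (-(γ * t * (m + 1) ^ d)) := by
      intro m
      rw [mul_assoc, ← Complex.exp_add]
      congr 2
      ring
    simp only [h3]
    rw [tsum_mul_left]
    change _ * powTheta d γ t = _
    have h4 : powTheta d γ t = powThetaConst d γ * (t : ℂ) ^ (-(1 / d) : ℂ)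
        + ∑ k ∈ Finset.range K, powThetaCoeff d γ k * (t : ℂ) ^ k + powThetaRem d γ K t := by
      rw [powThetaRem]; ring
    have h5 : (t : ℂ) ^ (s - 1 / d - 1) = (t : ℂ) ^ (s - 1) * (t : ℂ) ^ (-(1 / d) : ℂ) := by
      rw [← hcpow t ht]; congr 1; ring
    have h6 : ∀ k : ℕ, (t : ℂ) ^ (s + k - 1) = (t : ℂ) ^ (s - 1) * (t : ℂ) ^ k := by
      intro k
      rw [← Complex.cpow_natCast, ← hcpow t ht]; congr 1; ring
    rw [h4, h5, mul_add, mul_add, Finset.mul_sum]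
    congr 1
    · congr 1
      · ring
      · exact Finset.sum_congr rfl fun k _ => by rw [h6]; ring
    · ring
  have hk : ∀ k : ℕ, 0 < (s + k).re := fun k => by
    simp; linarith [k.cast_nonneg (α := ℝ)]
  have i1 : IntegrableOn (fun t : ℝ => powThetaConst d γ
            * ((t : ℂ) ^ (s - 1 / d - 1) * Complex.exp (-(A * t)))) (Set.Ioi 0) :=
    (integrableOn_cpow_mul_exp_neg hsd hA).const_mul _
  have i2 : ∀ k ∈ Finset.range K, IntegrableOn (fun t : ℝ => powThetaCoeff d γ k
            * ((t : ℂ) ^ (s + k - 1) * Complex.exp (-(A * t)))) (Set.Ioi 0) := fun k _ =>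
    (integrableOn_cpow_mul_exp_neg (hk k) hA).const_mul _
  have i3 := integrableOn_powSumRem hd hγ K hA
    (s := s) (by linarith [K.cast_nonneg (α := ℝ)])
  have i4 : IntegrableOn (fun t : ℝ => ∑ k ∈ Finset.range K, powThetaCoeff d γ k
      * ((t : ℂ) ^ (s + k - 1) * Complex.exp (-(A * t)))) (Set.Ioi 0) :=
    integrable_finsetSum _ i2
  have i5 : IntegrableOn (fun t : ℝ => powThetaConst d γ
      * ((t : ℂ) ^ (s - 1 / d - 1) * Complex.exp (-(A * t)))
      + ∑ k ∈ Finset.range K, powThetaCoeff d γ k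
        * ((t : ℂ) ^ (s + k - 1) * Complex.exp (-(A * t)))) (Set.Ioi 0) := i1.add i4
  rw [h2, integral_add i5 i3, integral_add i1 i4, integral_finsetSum _ i2, integral_const_mul,
    integral_cpow_mul_exp_neg_of_re_pos hsd hA] at h1
  simp only [integral_const_mul, integral_cpow_mul_exp_neg_of_re_pos (hk _) hA] at h1
  have h7 := h1.mul_right (Complex.Gamma s)⁻¹
  simp only [mul_inv_cancel_right₀ hG] at h7
  refine Eq.mp (congrArg (HasSum fun m : ℕ => (A + γ * ((m : ℂ) + 1) ^ d) ^ (-s)) ?_) h7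
  symm
  rw [add_mul, add_mul, Finset.sum_mul]
  congr 1
  · congr 1
    · ring
    · refine Finset.sum_congr rfl fun k _ => ?_
      rw [Complex.Gamma_add_natCast hs0]
      field_simp
  · rw [powSumRem, mellin, mul_comm]
    simp only [smul_eq_mul]

/-- `∑_{m ≥ 1} (a + m^d)^(-σ) ≪ a^(1/d - σ)` for `a ≥ 1`. -/
theorem exists_tsum_rpow_add_pow_le {d : ℕ} (hd : 1 ≤ d) {σ : ℝ} (hσ : 1 / (d : ℝ) < σ) :
    ∃ C : ℝ, 0 ≤ C ∧ ∀ a : ℝ, 1 ≤ a →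
      ∑' m : ℕ, (a + ((m : ℝ) + 1) ^ d) ^ (-σ) ≤ C * a ^ (-(σ - 1 / d)) := by
  have hd0 : (0 : ℝ) < d := by positivity
  -- The expansion with K = 0: one main term a^(1/d-σ) and a remainder of order a^(-σ), which is no
  -- larger because a ≥ 1.
  obtain ⟨M, -, hM⟩ := exists_norm_powSumRem_le hd (γ := 1) (by simp) 0
  let c : ℝ := ‖powThetaConst d 1 * (Complex.Gamma (σ - 1 / d) * (Complex.Gamma σ)⁻¹)‖
  have hσ0 : 0 < σ := lt_trans (by positivity) hσ
  refine ⟨c + |M σ|, by positivity, fun a ha => ?_⟩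
  have ha0 : 0 < a := by linarith
  have h1 := hasSum_cpow_add_mul_pow hd (γ := 1) (by simp) 0 (A := a) (s := σ) (by simpa using ha0)
    (by simpa using hσ)
  have h2 : ∀ m : ℕ, ((a : ℂ) + 1 * ((m : ℂ) + 1) ^ d) ^ (-(σ : ℂ))
      = (((a + ((m : ℝ) + 1) ^ d) ^ (-σ) : ℝ) : ℂ) := by
    intro m
    rw [Complex.ofReal_cpow (by positivity)]
    push_cast
    rw [one_mul]
  simp only [h2, Finset.range_zero, Finset.sum_empty, add_zero] at h1
  have h3 := h1.tsum_eq
  rw [← Complex.ofReal_tsum] at h3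
  have h4 := le_abs_self (∑' m : ℕ, (a + ((m : ℝ) + 1) ^ d) ^ (-σ))
  rw [← Real.norm_eq_abs, ← Complex.norm_real, h3] at h4
  refine h4.trans ((norm_add_le _ _).trans ?_)
  rw [add_mul]
  refine add_le_add ?_ ?_
  · rw [norm_mul]
    refine mul_le_mul_of_nonneg_left (le_of_eq ?_) (norm_nonneg _)
    rw [Complex.norm_cpow_eq_rpow_re_of_pos ha0]
    congr 1
    have : (-((σ : ℂ) - 1 / d)) = ((-(σ - 1 / d) : ℝ) : ℂ) := by push_cast; rfl
    rw [this, Complex.ofReal_re]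
  · refine (hM a σ (by simpa using ha0) (by simpa using hσ0)).trans ?_
    simp only [Complex.ofReal_re, CharP.cast_eq_zero, add_zero]
    gcongr
    · exact le_abs_self _
    · exact sub_le_self _ (by positivity)

/-! ### Absolute convergence of the multiple series -/

section FinSums
variable {M : Type*} [AddCommMonoid M] {n : ℕ}

theorem sum_Iic_last_fin (f : Fin (n + 2) → M) :
    ∑ i ∈ Finset.Iic (Fin.last (n + 1)), f i
      = ∑ i ∈ Finset.Iic (Fin.last n), f i.castSucc + f (Fin.last (n + 1)) := by
  have h1 : Finset.Iic (Fin.last (n + 1)) = Finset.univ := by ext; simp [Fin.le_last]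
  have h2 : Finset.Iic (Fin.last n) = Finset.univ := by ext; simp [Fin.le_last]
  rw [h1, h2, Fin.sum_univ_castSucc]

theorem sum_Ici_castSucc_fin (f : Fin (n + 1) → M) (j : Fin n) :
    ∑ i ∈ Finset.Ici j.castSucc, f i
      = ∑ i ∈ Finset.Ici j, f i.castSucc + f (Fin.last n) := by
  have h1 : Finset.Ici j.castSucc = Finset.univ.filter (j.castSucc ≤ ·) := by ext; simp
  have h2 : Finset.Ici j = Finset.univ.filter (j ≤ ·) := by ext; simp
  rw [h1, h2, Finset.sum_filter, Finset.sum_filter, Fin.sum_univ_castSucc]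
  simp [Fin.le_last]

theorem sum_Ici_last_fin (f : Fin (n + 1) → M) :
    ∑ i ∈ Finset.Ici (Fin.last n), f i = f (Fin.last n) := by
  have h1 : Finset.Ici (Fin.last n) = {Fin.last n} := by
    ext; simp [Fin.last_le_iff]
  rw [h1, Finset.sum_singleton]

end FinSums

/-- `m_1^{d_1} + ⋯ + m_j^{d_j}`. -/
noncomputable def realPowSum {n : ℕ} (d : Fin n → ℕ) (m : Fin n → ℕ+) (j : Fin n) : ℝ :=
  ∑ i ∈ Finset.Iic j, ((m i : ℕ) : ℝ) ^ d i

/-- `γ_1 m_1^{d_1} + ⋯ + γ_j m_j^{d_j}`. -/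
noncomputable def powSum {n : ℕ} (d : Fin n → ℕ) (γ : Fin n → ℂ) (m : Fin n → ℕ+) (j : Fin n) : ℂ :=
  ∑ i ∈ Finset.Iic j, γ i * ((m i : ℕ) : ℂ) ^ d i

/-- `∏_j (m_1^{d_1} + ⋯ + m_j^{d_j})^{-σ_j}`. -/
noncomputable def realTerm {n : ℕ} (d : Fin n → ℕ) (σ : Fin n → ℝ) (m : Fin n → ℕ+) : ℝ :=
  ∏ j, realPowSum d m j ^ (-σ j)

theorem one_le_realPowSum {n : ℕ} (d : Fin n → ℕ) (m : Fin n → ℕ+) (j : Fin n) :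
    1 ≤ realPowSum d m j := by
  have h1 : ∀ i, (1 : ℝ) ≤ ((m i : ℕ) : ℝ) ^ d i := fun i =>
    one_le_pow₀ (by exact_mod_cast (m i).pos)
  exact (h1 j).trans (Finset.single_le_sum (f := fun i => ((m i : ℕ) : ℝ) ^ d i)
    (fun i _ => zero_le_one.trans (h1 i)) (Finset.mem_Iic.2 le_rfl))

theorem realTerm_nonneg {n : ℕ} (d : Fin n → ℕ) (σ : Fin n → ℝ) (m : Fin n → ℕ+) :
    0 ≤ realTerm d σ m :=
  Finset.prod_nonneg fun j _ =>
    Real.rpow_nonneg (zero_le_one.trans (one_le_realPowSum d m j)) _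

theorem realTerm_anti {n : ℕ} (d : Fin n → ℕ) {σ τ : Fin n → ℝ} (h : ∀ j, τ j ≤ σ j)
    (m : Fin n → ℕ+) : realTerm d σ m ≤ realTerm d τ m := by
  refine Finset.prod_le_prod (fun j _ =>
    Real.rpow_nonneg (zero_le_one.trans (one_le_realPowSum d m j)) _) fun j _ => ?_
  exact Real.rpow_le_rpow_of_exponent_le (one_le_realPowSum d m j) (neg_le_neg (h j))

/-- Appending a last summation variable. -/
def snocPNatEquiv (n : ℕ) : (Fin n → ℕ+) × ℕ ≃ (Fin (n + 1) → ℕ+) :=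
  ((Equiv.prodCongr (Equiv.refl _) Equiv.pnatEquivNat.symm).trans (Equiv.prodComm _ _)).trans
    (Fin.snocEquiv fun _ => ℕ+)

theorem snocPNatEquiv_castSucc {n : ℕ} (p : (Fin n → ℕ+) × ℕ) (i : Fin n) :
    snocPNatEquiv n p i.castSucc = p.1 i := by
  simp [snocPNatEquiv, Fin.snocEquiv]

theorem snocPNatEquiv_last {n : ℕ} (p : (Fin n → ℕ+) × ℕ) :
    ((snocPNatEquiv n p (Fin.last n) : ℕ+) : ℕ) = p.2 + 1 := by
  simp [snocPNatEquiv, Fin.snocEquiv, Equiv.pnatEquivNat]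

/-- The tuple `(s_1, …, s_{n-1}, s_n + s_{n+1} + w)`. -/
def mergeLast {R : Type*} [AddCommMonoid R] {n : ℕ} (w : R) (s : Fin (n + 2) → R) :
    Fin (n + 1) → R :=
  fun j => s j.castSucc + if j = Fin.last n then s (Fin.last (n + 1)) + w else 0

/-- Domains and regions are all cut out by conditions on tail sums, so this identity governs how
they behave under merging. -/
theorem sum_Ici_mergeLast {R : Type*} [AddCommMonoid R] {n : ℕ} (w : R) (s : Fin (n + 2) → R)
    (j : Fin (n + 1)) :
    ∑ i ∈ Finset.Ici j, mergeLast w s i = ∑ i ∈ Finset.Ici j.castSucc, s i + w := by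
  simp only [mergeLast]
  rw [Finset.sum_add_distrib, Finset.sum_ite_eq', if_pos (Finset.mem_Ici.2 (Fin.le_last j)),
    sum_Ici_castSucc_fin, add_assoc]

theorem realTerm_snoc {n : ℕ} (d : Fin (n + 2) → ℕ) (σ : Fin (n + 2) → ℝ)
    (p : (Fin (n + 1) → ℕ+) × ℕ) :
    realTerm d σ (snocPNatEquiv (n + 1) p)
      = realTerm (fun i => d i.castSucc) (fun i => σ i.castSucc) p.1
        * (realPowSum (fun i => d i.castSucc) p.1 (Fin.last n)
          + ((p.2 : ℝ) + 1) ^ d (Fin.last (n + 1))) ^ (-σ (Fin.last (n + 1))) := by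
  rw [realTerm, Fin.prod_univ_castSucc, realTerm]
  congr 2
  · refine funext fun j => ?_
    simp only [realPowSum, Fin.sum_Iic_castSucc, snocPNatEquiv_castSucc]
  · simp only [realPowSum, sum_Iic_last_fin, snocPNatEquiv_castSucc, snocPNatEquiv_last]
    push_cast
    rfl

theorem realTerm_mergeLast {n : ℕ} (d : Fin (n + 1) → ℕ) (σ : Fin (n + 2) → ℝ) (w : ℝ)
    (m : Fin (n + 1) → ℕ+) :
    realTerm d (mergeLast w σ) m = realTerm d (fun i => σ i.castSucc) m
      * realPowSum d m (Fin.last n) ^ (-(σ (Fin.last (n + 1)) + w)) := by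
  have h1 := zero_lt_one.trans_le (one_le_realPowSum d m (Fin.last n))
  rw [realTerm, realTerm, Fin.prod_univ_castSucc, Fin.prod_univ_castSucc, mul_assoc,
    ← Real.rpow_add h1]
  congr 1
  · refine Finset.prod_congr rfl fun j _ => ?_
    simp [mergeLast, Fin.castSucc_ne_last]
  · congr 1
    simp [mergeLast]
    ring

/-- Summing over the last variable costs a factor of order (preceding base)^(1/d-σ), which is
merging with w = -1/d. The tail conditions lose 1/d on both sides and so pass to one variable fewer.
-/
theorem summable_realTerm {n : ℕ} {d : Fin (n + 1) → ℕ} (hd : ∀ j, 1 ≤ d j) {σ : Fin (n + 1) → ℝ}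
    (hσ : ∀ j, ∑ i ∈ Finset.Ici j, (1 / (d i : ℝ)) < ∑ i ∈ Finset.Ici j, σ i) :
    Summable (realTerm d σ) := by
  induction n with
  | zero =>
    have h0 := hσ (Fin.last 0)
    rw [sum_Ici_last_fin, sum_Ici_last_fin] at h0
    have h1 := summable_rpow_add_mul_pow (hd (Fin.last 0)) le_rfl one_pos h0
    let e : ℕ ≃ (Fin 1 → ℕ+) := Equiv.pnatEquivNat.symm.trans (Equiv.funUnique (Fin 1) ℕ+).symm
    rw [← e.summable_iff]
    refine h1.congr fun m => ?_
    have h2 : Finset.Iic (0 : Fin 1) = {0} := rfl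
    simp [h2, realTerm, realPowSum, e, Equiv.pnatEquivNat]
  | succ n ih =>
    have hlast := hσ (Fin.last (n + 1))
    rw [sum_Ici_last_fin, sum_Ici_last_fin] at hlast
    obtain ⟨C, hC0, hC⟩ := exists_tsum_rpow_add_pow_le (hd (Fin.last (n + 1))) hlast
    rw [← (snocPNatEquiv (n + 1)).summable_iff, summable_prod_of_nonneg
      (f := realTerm d σ ∘ snocPNatEquiv (n + 1)) fun p => realTerm_nonneg _ _ _]
    simp only [Function.comp_apply, realTerm_snoc]
    refine ⟨fun m => Summable.mul_left _ ?_, ?_⟩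
    · simpa using summable_rpow_add_mul_pow (hd (Fin.last (n + 1)))
        (zero_le_one.trans (one_le_realPowSum (fun i => d i.castSucc) m (Fin.last n)))
        one_pos hlast
    · have h2 := (ih (d := fun i => d i.castSucc)
        (σ := mergeLast (-(1 / (d (Fin.last (n + 1)) : ℝ))) σ) (fun j => hd _) fun j => by
          have := hσ j.castSucc
          rw [sum_Ici_castSucc_fin] at this
          rw [sum_Ici_mergeLast]
          linarith).mul_left C
      refine Summable.of_nonneg_of_le (fun m => ?_) (fun m => ?_) h2
      · refine tsum_nonneg fun k => mul_nonneg (realTerm_nonneg _ _ _) (Real.rpow_nonneg ?_ _)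
        have := one_le_realPowSum (fun i => d i.castSucc) m (Fin.last n)
        positivity
      · rw [tsum_mul_left, realTerm_mergeLast, mul_left_comm]
        refine mul_le_mul_of_nonneg_left ?_ (realTerm_nonneg _ _ _)
        exact hC _ (one_le_realPowSum _ _ _)

theorem multiZetaTerm_eq_prod {n : ℕ} (d : Fin n → ℕ) (γ s : Fin n → ℂ) (m : Fin n → ℕ+) :
    multiZetaTerm d γ s m = ∏ j, powSum d γ m j ^ (-s j) := by
  simp only [multiZetaTerm, powSum, Complex.cpow_neg, one_div, Finset.prod_inv_distrib]

theorem multiZetaTerm_snoc {n : ℕ} (d : Fin (n + 2) → ℕ) (γ s : Fin (n + 2) → ℂ)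
    (p : (Fin (n + 1) → ℕ+) × ℕ) :
    multiZetaTerm d γ s (snocPNatEquiv (n + 1) p)
      = multiZetaTerm (fun i => d i.castSucc) (fun i => γ i.castSucc) (fun i => s i.castSucc) p.1
        * (powSum (fun i => d i.castSucc) (fun i => γ i.castSucc) p.1 (Fin.last n)
          + γ (Fin.last (n + 1)) * ((p.2 : ℂ) + 1) ^ d (Fin.last (n + 1)))
            ^ (-s (Fin.last (n + 1))) := by
  rw [multiZetaTerm_eq_prod, Fin.prod_univ_castSucc, multiZetaTerm_eq_prod]
  congr 2
  · refine funext fun j => ?_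
    simp only [powSum, Fin.sum_Iic_castSucc, snocPNatEquiv_castSucc]
  · simp only [powSum, sum_Iic_last_fin, snocPNatEquiv_castSucc, snocPNatEquiv_last]
    push_cast
    rfl

theorem re_powSum {n : ℕ} (d : Fin n → ℕ) (γ : Fin n → ℂ) (m : Fin n → ℕ+) (j : Fin n) :
    (powSum d γ m j).re = ∑ i ∈ Finset.Iic j, (γ i).re * ((m i : ℕ) : ℝ) ^ d i := by
  rw [powSum, Complex.re_sum]
  refine Finset.sum_congr rfl fun i _ => ?_
  have : ((m i : ℕ) : ℂ) ^ d i = (((m i : ℕ) : ℝ) ^ d i : ℝ) := by push_cast; rfl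
  rw [this, Complex.re_mul_ofReal]

/-- A single constant dominating all |γ_i| and all 1/Re γ_i reduces estimates for complex bases to
the case where every γ_i is 1. -/
theorem exists_powSum_bounds {n : ℕ} (d : Fin n → ℕ) {γ : Fin n → ℂ} (hγ : ∀ j, 0 < (γ j).re) :
    ∃ c : ℝ, 1 ≤ c ∧ ∀ m j, c⁻¹ * realPowSum d m j ≤ (powSum d γ m j).re ∧
      ‖powSum d γ m j‖ ≤ c * realPowSum d m j := by
  refine ⟨1 + ∑ i, (‖γ i‖ + (γ i).re⁻¹), ?_, fun m j => ⟨?_, ?_⟩⟩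
  · have : 0 ≤ ∑ i, (‖γ i‖ + (γ i).re⁻¹) := Finset.sum_nonneg fun i _ => by
      have := hγ i
      positivity
    linarith
  · rw [re_powSum, realPowSum, Finset.mul_sum]
    refine Finset.sum_le_sum fun i _ => mul_le_mul_of_nonneg_right ?_ (by positivity)
    refine inv_le_of_inv_le₀ (hγ i) ?_
    have h1 := Finset.single_le_sum (f := fun i => ‖γ i‖ + (γ i).re⁻¹) (fun i _ => by
      have := hγ i
      positivity) (Finset.mem_univ i)
    have h2 := norm_nonneg (γ i)
    linarith
  · rw [powSum, realPowSum, Finset.mul_sum]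
    refine norm_sum_le_of_le _ fun i _ => ?_
    rw [norm_mul, norm_pow, Complex.norm_natCast]
    refine mul_le_mul_of_nonneg_right ?_ (by positivity)
    have h1 := Finset.single_le_sum (f := fun i => ‖γ i‖ + (γ i).re⁻¹) (fun i _ => by
      have := hγ i
      positivity) (Finset.mem_univ i)
    have h2 := inv_pos.2 (hγ i)
    linarith

theorem powSum_re_pos {n : ℕ} (d : Fin n → ℕ) {γ : Fin n → ℂ} (hγ : ∀ j, 0 < (γ j).re)
    (m : Fin n → ℕ+) (j : Fin n) : 0 < (powSum d γ m j).re := by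
  rw [re_powSum]
  refine Finset.sum_pos (fun i _ => mul_pos (hγ i) (pow_pos (by exact_mod_cast (m i).pos) _))
    ⟨j, by simp⟩

theorem powSum_ne_zero {n : ℕ} (d : Fin n → ℕ) {γ : Fin n → ℂ} (hγ : ∀ j, 0 < (γ j).re)
    (m : Fin n → ℕ+) (j : Fin n) : powSum d γ m j ≠ 0 := by
  intro h
  have := powSum_re_pos d hγ m j
  rw [h] at this
  exact lt_irrefl _ this

theorem multiZetaTerm_mergeLast {n : ℕ} (d : Fin (n + 1) → ℕ) {γ : Fin (n + 1) → ℂ}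
    (hγ : ∀ j, 0 < (γ j).re) (s : Fin (n + 2) → ℂ) (w : ℂ) (m : Fin (n + 1) → ℕ+) :
    multiZetaTerm d γ (mergeLast w s) m = multiZetaTerm d γ (fun i => s i.castSucc) m
      * powSum d γ m (Fin.last n) ^ (-(s (Fin.last (n + 1)) + w)) := by
  rw [multiZetaTerm_eq_prod, multiZetaTerm_eq_prod, Fin.prod_univ_castSucc,
    Fin.prod_univ_castSucc, mul_assoc, ← Complex.cpow_add _ _ (powSum_ne_zero d hγ m _)]
  congr 1
  · refine Finset.prod_congr rfl fun j _ => ?_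
    simp [mergeLast, Fin.castSucc_ne_last]
  · congr 1
    simp [mergeLast]
    ring

/-- If `c⁻¹ b ≤ x ≤ c b` then `x^(-σ) ≤ c^|σ| b^(-σ)`. -/
theorem rpow_neg_le_of_comparable {b c x σ : ℝ} (hb : 0 < b) (hc : 1 ≤ c) (h1 : c⁻¹ * b ≤ x)
    (h2 : x ≤ c * b) : x ^ (-σ) ≤ c ^ |σ| * b ^ (-σ) := by
  have hc0 : 0 < c := by linarith
  rcases le_total 0 σ with h | h
  · rw [abs_of_nonneg h]
    calc x ^ (-σ) ≤ (c⁻¹ * b) ^ (-σ) :=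
          Real.rpow_le_rpow_of_nonpos (by positivity) h1 (by linarith)
      _ = _ := by
          rw [Real.mul_rpow (by positivity) hb.le, Real.inv_rpow hc0.le, Real.rpow_neg hc0.le,
            inv_inv]
  · rw [abs_of_nonpos h]
    calc x ^ (-σ) ≤ (c * b) ^ (-σ) :=
          Real.rpow_le_rpow ((by positivity : (0 : ℝ) ≤ c⁻¹ * b).trans h1) h2 (by linarith)
      _ = _ := Real.mul_rpow hc0.le hb.le

/-- For principal powers |z^(-s)| = |z|^(-Re s) exp(arg z · Im s), and |arg z| ≤ π bounds the
exponential uniformly in the summation variables. -/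
theorem exists_norm_multiZetaTerm_le {n : ℕ} (d : Fin n → ℕ) {γ : Fin n → ℂ}
    (hγ : ∀ j, 0 < (γ j).re) : ∃ M : (Fin n → ℂ) → ℝ, Continuous M ∧ (∀ s, 0 ≤ M s) ∧ ∀ s m,
      ‖multiZetaTerm d γ s m‖ ≤ M s * realTerm d (fun j => (s j).re) m := by
  obtain ⟨c, hc, hb⟩ := exists_powSum_bounds d hγ
  have hc0 : 0 < c := by linarith
  refine ⟨fun s => ∏ j, (c ^ |(s j).re| * Real.exp (Real.pi * |(s j).im|)), ?_,
    fun s => Finset.prod_nonneg fun j _ => by positivity, fun s m => ?_⟩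
  · refine continuous_finsetProd _ fun j _ => Continuous.mul ?_ (by fun_prop)
    exact continuous_const.rpow (by fun_prop) fun _ => Or.inl hc0.ne'
  · rw [multiZetaTerm_eq_prod, realTerm, norm_prod, ← Finset.prod_mul_distrib]
    refine Finset.prod_le_prod (fun j _ => norm_nonneg _) fun j _ => ?_
    rw [Complex.norm_cpow_of_ne_zero (powSum_ne_zero d hγ m j), div_eq_mul_inv, ← Real.exp_neg]
    have h1 : ‖powSum d γ m j‖ ^ (-s j).re
        ≤ c ^ |(s j).re| * realPowSum d m j ^ (-(s j).re) :=
      rpow_neg_le_of_comparable (zero_lt_one.trans_le (one_le_realPowSum d m j)) hc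
        ((hb m j).1.trans (Complex.re_le_norm _)) (hb m j).2
    have h2 : Real.exp (-(Complex.arg (powSum d γ m j) * (-s j).im))
        ≤ Real.exp (Real.pi * |(s j).im|) := by
      rw [Real.exp_le_exp, Complex.neg_im, mul_neg, neg_neg]
      refine (le_abs_self _).trans ?_
      rw [abs_mul]
      exact mul_le_mul_of_nonneg_right (Complex.abs_arg_le_pi _) (abs_nonneg _)
    calc _ ≤ (c ^ |(s j).re| * realPowSum d m j ^ (-(s j).re))
          * Real.exp (Real.pi * |(s j).im|) := by
          have := zero_lt_one.trans_le (one_le_realPowSum d m j)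
          gcongr
      _ = _ := by ring

theorem mem_multiZetaDomain_iff {n : ℕ} {d : Fin n → ℕ} {s : Fin n → ℂ} :
    s ∈ multiZetaDomain d ↔
      ∀ j, ∑ i ∈ Finset.Ici j, (1 / (d i : ℝ)) < ∑ i ∈ Finset.Ici j, (s i).re := by
  simp only [multiZetaDomain, Set.mem_ofPred_eq, Complex.re_sum]

theorem summable_multiZetaTerm {n : ℕ} {d : Fin (n + 1) → ℕ} (hd : ∀ j, 1 ≤ d j)
    {γ : Fin (n + 1) → ℂ} (hγ : ∀ j, 0 < (γ j).re) {s : Fin (n + 1) → ℂ}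
    (hs : s ∈ multiZetaDomain d) : Summable (multiZetaTerm d γ s) := by
  obtain ⟨M, -, -, hM⟩ := exists_norm_multiZetaTerm_le d hγ
  exact Summable.of_norm_bounded
    ((summable_realTerm hd (mem_multiZetaDomain_iff.1 hs)).mul_left (M s)) (hM s)

/-! ### Recursion over the number of variables -/

/-- The sum of the multiple series on its domain of convergence. -/
noncomputable def multiZetaSum {n : ℕ} (d : Fin n → ℕ) (γ s : Fin n → ℂ) : ℂ :=
  ∑' m, multiZetaTerm d γ s m

/-- The contribution of the remainders in the last summation variable. -/
noncomputable def multiZetaRem {n : ℕ} (d : Fin (n + 2) → ℕ) (γ : Fin (n + 2) → ℂ) (K : ℕ)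
    (s : Fin (n + 2) → ℂ) : ℂ :=
  ∑' m : Fin (n + 1) → ℕ+,
    multiZetaTerm (fun i => d i.castSucc) (fun i => γ i.castSucc) (fun i => s i.castSucc) m
      * powSumRem (d (Fin.last (n + 1))) (γ (Fin.last (n + 1))) K
        (powSum (fun i => d i.castSucc) (fun i => γ i.castSucc) m (Fin.last n))
        (s (Fin.last (n + 1)))

/-- A region on which `multiZetaRem d γ K` is holomorphic. -/
def multiZetaRemDomain {n : ℕ} (d : Fin (n + 2) → ℕ) (K : ℕ) : Set (Fin (n + 2) → ℂ) :=
  {s | -(K : ℝ) < (s (Fin.last (n + 1))).re} ∩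
    mergeLast (K : ℂ) ⁻¹' multiZetaDomain fun i => d i.castSucc

theorem continuous_mergeLast {n : ℕ} (w : ℂ) :
    Continuous (mergeLast w : (Fin (n + 2) → ℂ) → Fin (n + 1) → ℂ) := by
  refine continuous_pi fun j => ?_
  unfold mergeLast
  split_ifs <;> fun_prop

theorem isOpen_multiZetaDomain {n : ℕ} (d : Fin n → ℕ) : IsOpen (multiZetaDomain d) := by
  have : multiZetaDomain d = ⋂ j, {s : Fin n → ℂ |
      ∑ i ∈ Finset.Ici j, (1 / (d i : ℝ)) < (∑ i ∈ Finset.Ici j, s i).re} := by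
    ext s; simp [multiZetaDomain]
  rw [this]
  exact isOpen_iInter_of_finite fun j => isOpen_lt continuous_const (by fun_prop)

theorem isOpen_multiZetaRemDomain {n : ℕ} (d : Fin (n + 2) → ℕ) (K : ℕ) :
    IsOpen (multiZetaRemDomain d K) :=
  (isOpen_lt continuous_const (Complex.continuous_re.comp (continuous_apply _))).inter
    ((isOpen_multiZetaDomain _).preimage (continuous_mergeLast _))

theorem exists_locally_summable_multiZetaRem {n : ℕ} {d : Fin (n + 2) → ℕ} (hd : ∀ j, 1 ≤ d j)
    {γ : Fin (n + 2) → ℂ} (hγ : ∀ j, 0 < (γ j).re) (K : ℕ) {s₀ : Fin (n + 2) → ℂ}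
    (hs₀ : s₀ ∈ multiZetaRemDomain d K) :
    ∃ V ∈ 𝓝 s₀, ∃ u : (Fin (n + 1) → ℕ+) → ℝ, Summable u ∧ ∀ m, ∀ s ∈ V,
      ‖multiZetaTerm (fun i => d i.castSucc) (fun i => γ i.castSucc) (fun i => s i.castSucc) m
      * powSumRem (d (Fin.last (n + 1))) (γ (Fin.last (n + 1))) K
        (powSum (fun i => d i.castSucc) (fun i => γ i.castSucc) m (Fin.last n))
        (s (Fin.last (n + 1)))‖ ≤ u m := by
  set d' : Fin (n + 1) → ℕ := fun i => d i.castSucc with hd'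
  set γ' : Fin (n + 1) → ℂ := fun i => γ i.castSucc with hγ'
  have hγ'' : ∀ j, 0 < (γ' j).re := fun j => hγ _
  obtain ⟨c, hc, hb⟩ := exists_powSum_bounds d' hγ''
  have hc0 : 0 < c := by linarith
  obtain ⟨M₁, hM₁c, hM₁0, hM₁⟩ := exists_norm_multiZetaTerm_le d' hγ''
  obtain ⟨M₂, hM₂c, hM₂⟩ := exists_norm_powSumRem_le (hd (Fin.last (n + 1)))
    (hγ (Fin.last (n + 1))) K
  let σ : (Fin (n + 2) → ℂ) → Fin (n + 1) → ℝ := fun s => mergeLast (K : ℝ) fun i => (s i).re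
  have hσ : ∀ s j, σ s j = (mergeLast (K : ℂ) s j).re := by
    intro s j
    simp only [σ, mergeLast, Complex.add_re]
    split_ifs <;> simp
  have hσc : ∀ j, Continuous fun s => σ s j := by
    intro j
    simp only [hσ]
    exact Complex.continuous_re.comp ((continuous_apply j).comp (continuous_mergeLast _))
  -- The convergence conditions are finitely many strict inequalities, so all exponents at s₀ can be
  -- lowered by some ε. The bases are at least 1, so the lowered exponents give a majorant for every
  -- s near s₀.
  obtain ⟨ε, hε, hεD⟩ : ∃ ε : ℝ, 0 < ε ∧ ∀ j, ∑ i ∈ Finset.Ici j, (1 / (d' i : ℝ))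
      < ∑ i ∈ Finset.Ici j, (σ s₀ i - ε) := by
    have h1 : ∀ᶠ ε in 𝓝 (0 : ℝ), ∀ j, ∑ i ∈ Finset.Ici j, (1 / (d' i : ℝ))
      < ∑ i ∈ Finset.Ici j, (σ s₀ i - ε) := by
      rw [eventually_all]
      intro j
      refine (isOpen_lt continuous_const (by fun_prop)).mem_nhds ?_
      have := mem_multiZetaDomain_iff.1 hs₀.2 j
      simpa [hσ] using this
    obtain ⟨ε, h2, h3⟩ := ((h1.filter_mono nhdsWithin_le_nhds).and
      (self_mem_nhdsWithin (a := (0 : ℝ)) (s := Set.Ioi 0))).exists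
    exact ⟨ε, h3, h2⟩
  -- All factors independent of the summation variables; by continuity they stay below Q s₀ + 1 near
  -- s₀.
  let Q : (Fin (n + 2) → ℂ) → ℝ := fun s => M₁ (fun i => s i.castSucc)
    * (|M₂ (s (Fin.last (n + 1)))| * c ^ |(s (Fin.last (n + 1))).re + K|)
  have hQ : ContinuousAt Q s₀ := by
    refine ContinuousAt.mul (hM₁c.comp (by fun_prop)).continuousAt (ContinuousAt.mul ?_ ?_)
    · refine ContinuousAt.abs (ContinuousAt.comp (f := fun s : Fin (n + 2) → ℂ =>
        s (Fin.last (n + 1))) (hM₂c.continuousAt ?_) (continuous_apply _).continuousAt)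
      exact (isOpen_lt continuous_const Complex.continuous_re).mem_nhds hs₀.1
    · exact (continuous_const.rpow (by fun_prop) fun _ => Or.inl hc0.ne').continuousAt
  refine ⟨{s | s ∈ multiZetaRemDomain d K ∧ Q s < Q s₀ + 1 ∧ ∀ j, σ s₀ j - ε < σ s j}, ?_,
    fun m => (Q s₀ + 1) * realTerm d' (fun j => σ s₀ j - ε) m,
    (summable_realTerm (fun j => hd _) hεD).mul_left _, fun m s hs => ?_⟩
  · refine inter_mem ((isOpen_multiZetaRemDomain d K).mem_nhds hs₀) (inter_mem
      (hQ.eventually_lt_const (by linarith)) ?_)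
    exact (eventually_all (p := fun j s => σ s₀ j - ε < σ s j)).2 fun j =>
      (hσc j).continuousAt.eventually_const_lt (by linarith)
  · obtain ⟨hs1, hs2, hs3⟩ := hs
    have hB := zero_lt_one.trans_le (one_le_realPowSum d' m (Fin.last n))
    have h1 := hM₂ (powSum d' γ' m (Fin.last n)) (s (Fin.last (n + 1)))
      (powSum_re_pos d' hγ'' m _) hs1.1
    have h2 : (powSum d' γ' m (Fin.last n)).re ^ (-((s (Fin.last (n + 1))).re + K))
        ≤ c ^ |(s (Fin.last (n + 1))).re + K|
          * realPowSum d' m (Fin.last n) ^ (-((s (Fin.last (n + 1))).re + K)) :=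
      rpow_neg_le_of_comparable hB hc (hb m _).1 ((Complex.re_le_norm _).trans (hb m _).2)
    rw [norm_mul]
    calc _ ≤ (M₁ (fun i => s i.castSucc) * realTerm d' (fun j => (s j.castSucc).re) m)
          * (|M₂ (s (Fin.last (n + 1)))| * (c ^ |(s (Fin.last (n + 1))).re + K|
          * realPowSum d' m (Fin.last n) ^ (-((s (Fin.last (n + 1))).re + K)))) := by
          refine mul_le_mul (hM₁ _ m) ?_ (norm_nonneg _)
            (mul_nonneg (hM₁0 _) (realTerm_nonneg _ _ _))
          refine h1.trans (mul_le_mul (le_abs_self _) h2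
            (Real.rpow_nonneg (powSum_re_pos d' hγ'' m _).le _) (abs_nonneg _))
      _ = Q s * realTerm d' (σ s) m := by
          rw [realTerm_mergeLast]
          simp only [Q]
          ring
      _ ≤ _ := mul_le_mul hs2.le (realTerm_anti d' (fun j => (hs3 j).le) m)
          (realTerm_nonneg _ _ _) (by
            have : 0 ≤ Q s₀ := mul_nonneg (hM₁0 _) (by positivity)
            linarith)

theorem differentiable_multiZetaTerm {n : ℕ} (d : Fin n → ℕ) {γ : Fin n → ℂ}
    (hγ : ∀ j, 0 < (γ j).re) (m : Fin n → ℕ+) :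
    Differentiable ℂ fun s => multiZetaTerm d γ s m := by
  simp only [multiZetaTerm_eq_prod]
  intro s
  refine (HasFDerivAt.finsetProd fun j _ => DifferentiableAt.hasFDerivAt ?_).differentiableAt
  exact DifferentiableAt.const_cpow (by fun_prop) (Or.inl (powSum_ne_zero d hγ m j))

theorem analyticOnNhd_multiZetaRem {n : ℕ} {d : Fin (n + 2) → ℕ} (hd : ∀ j, 1 ≤ d j)
    {γ : Fin (n + 2) → ℂ} (hγ : ∀ j, 0 < (γ j).re) (K : ℕ) :
    AnalyticOnNhd ℂ (multiZetaRem d γ K) (multiZetaRemDomain d K) := by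
  refine analyticOnNhd_tsum_of_locally_summable (isOpen_multiZetaRemDomain d K) (fun m s hs => ?_)
    fun s hs => exists_locally_summable_multiZetaRem hd hγ K hs
  refine (DifferentiableAt.mul ?_ ?_).differentiableWithinAt
  · exact DifferentiableAt.comp (f := fun (s : Fin (n + 2) → ℂ) (i : Fin (n + 1)) => s i.castSucc) s
      (differentiable_multiZetaTerm _ (fun j => hγ _) m _) (by fun_prop)
  · exact DifferentiableAt.comp (f := fun s : Fin (n + 2) → ℂ => s (Fin.last (n + 1))) s
      (differentiableAt_powSumRem (hd _) (hγ _) K (powSum_re_pos _ (fun j => hγ _) m _) hs.1)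
      (by fun_prop)

theorem multiZetaRem_eq_zero {n : ℕ} (d : Fin (n + 2) → ℕ) (γ : Fin (n + 2) → ℂ) (K N : ℕ)
    {s : Fin (n + 2) → ℂ} (hs : s (Fin.last (n + 1)) = -N) : multiZetaRem d γ K s = 0 := by
  simp [multiZetaRem, hs, powSumRem_neg_nat]

theorem mergeLast_mem_multiZetaDomain {n : ℕ} {d : Fin (n + 2) → ℕ} {s : Fin (n + 2) → ℂ}
    (hs : s ∈ multiZetaDomain d) {w : ℂ} (hw : -(1 / (d (Fin.last (n + 1)) : ℝ)) ≤ w.re) :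
    mergeLast w s ∈ multiZetaDomain fun i => d i.castSucc := by
  intro j
  have := hs j.castSucc
  rw [sum_Ici_castSucc_fin] at this
  rw [sum_Ici_mergeLast, Complex.add_re]
  linarith

/-- Summing over the last variable expresses the `(n + 1)`-fold series through `n`-fold ones. -/
theorem multiZetaSum_eq {n : ℕ} {d : Fin (n + 2) → ℕ} (hd : ∀ j, 1 ≤ d j)
    {γ : Fin (n + 2) → ℂ} (hγ : ∀ j, 0 < (γ j).re) (K : ℕ) {s : Fin (n + 2) → ℂ}
    (hs : s ∈ multiZetaDomain d) :
    multiZetaSum d γ s =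
      powThetaConst (d (Fin.last (n + 1))) (γ (Fin.last (n + 1)))
        * (Complex.Gamma (s (Fin.last (n + 1)) - 1 / d (Fin.last (n + 1)))
          * (Complex.Gamma (s (Fin.last (n + 1))))⁻¹)
        * multiZetaSum (fun i => d i.castSucc) (fun i => γ i.castSucc)
          (mergeLast (-(1 / d (Fin.last (n + 1)))) s)
      + ∑ k ∈ Finset.range K, powThetaCoeff (d (Fin.last (n + 1))) (γ (Fin.last (n + 1))) k
        * (∏ i ∈ Finset.range k, (s (Fin.last (n + 1)) + i))
        * multiZetaSum (fun i => d i.castSucc) (fun i => γ i.castSucc) (mergeLast (k : ℂ) s)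
      + multiZetaRem d γ K s := by
  set d' : Fin (n + 1) → ℕ := fun i => d i.castSucc with hd'
  set γ' : Fin (n + 1) → ℂ := fun i => γ i.castSucc with hγ'
  have hγ'' : ∀ j, 0 < (γ' j).re := fun j => hγ _
  have hlast : 1 / (d (Fin.last (n + 1)) : ℝ) < (s (Fin.last (n + 1))).re := by
    have := hs (Fin.last (n + 1))
    rwa [sum_Ici_last_fin, sum_Ici_last_fin] at this
  have hk : ∀ k : ℕ, -(1 / (d (Fin.last (n + 1)) : ℝ)) ≤ (k : ℂ).re := fun k => by
    have h1 : 0 ≤ 1 / (d (Fin.last (n + 1)) : ℝ) := by positivity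
    have h2 : (0 : ℝ) ≤ k := by positivity
    rw [Complex.natCast_re]
    linarith
  have hw : (-(1 / d (Fin.last (n + 1))) : ℂ).re = -(1 / (d (Fin.last (n + 1)) : ℝ)) := by
    have : (1 / d (Fin.last (n + 1)) : ℂ) = ((1 / d (Fin.last (n + 1)) : ℝ) : ℂ) := by
      push_cast; rfl
    rw [Complex.neg_re, this, Complex.ofReal_re]
  have hsK : s ∈ multiZetaRemDomain d K := by
    refine ⟨?_, mergeLast_mem_multiZetaDomain hs (hk K)⟩
    have h1 : 0 ≤ 1 / (d (Fin.last (n + 1)) : ℝ) := by positivity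
    have h2 : (0 : ℝ) ≤ K := by positivity
    exact lt_of_le_of_lt (by linarith) hlast
  have hsum₀ : Summable (multiZetaTerm d γ s) := summable_multiZetaTerm hd hγ hs
  have hsum : Summable fun p => multiZetaTerm d γ s (snocPNatEquiv (n + 1) p) :=
    hsum₀.comp_injective (snocPNatEquiv (n + 1)).injective
  have s1 : Summable (multiZetaTerm d' γ' (mergeLast (-(1 / d (Fin.last (n + 1))) : ℂ) s)) :=
    summable_multiZetaTerm (d := d') (fun j => hd j.castSucc) hγ''
      (mergeLast_mem_multiZetaDomain hs hw.ge)
  have s2 : ∀ k : ℕ, Summable (multiZetaTerm d' γ' (mergeLast (k : ℂ) s)) := fun k =>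
    summable_multiZetaTerm (d := d') (fun j => hd j.castSucc) hγ'' (mergeLast_mem_multiZetaDomain hs (hk k))
  have s3 : Summable fun m : Fin (n + 1) → ℕ+ => multiZetaTerm d' γ' (fun i => s i.castSucc) m
      * powSumRem (d (Fin.last (n + 1))) (γ (Fin.last (n + 1))) K
        (powSum d' γ' m (Fin.last n)) (s (Fin.last (n + 1))) := by
    obtain ⟨V, hV, u, hu, hle⟩ := exists_locally_summable_multiZetaRem hd hγ K hsK
    exact Summable.of_norm_bounded hu fun m => hle m s (mem_of_mem_nhds hV)
  rw [multiZetaSum, ← (snocPNatEquiv (n + 1)).tsum_eq (multiZetaTerm d γ s),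
    hsum.tsum_prod]
  -- The one-variable expansion with A the last base of the shorter tuple; each resulting power of A
  -- is absorbed into the exponent already on that base.
  have hin : ∀ m : Fin (n + 1) → ℕ+, ∑' k : ℕ, multiZetaTerm d γ s (snocPNatEquiv (n + 1) (m, k))
      = powThetaConst (d (Fin.last (n + 1))) (γ (Fin.last (n + 1)))
        * (Complex.Gamma (s (Fin.last (n + 1)) - 1 / d (Fin.last (n + 1)))
          * (Complex.Gamma (s (Fin.last (n + 1))))⁻¹)
        * multiZetaTerm d' γ' (mergeLast (-(1 / d (Fin.last (n + 1)))) s) m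
      + ∑ k ∈ Finset.range K, powThetaCoeff (d (Fin.last (n + 1))) (γ (Fin.last (n + 1))) k
        * (∏ i ∈ Finset.range k, (s (Fin.last (n + 1)) + i))
        * multiZetaTerm d' γ' (mergeLast (k : ℂ) s) m
      + multiZetaTerm d' γ' (fun i => s i.castSucc) m
      * powSumRem (d (Fin.last (n + 1))) (γ (Fin.last (n + 1))) K
        (powSum d' γ' m (Fin.last n)) (s (Fin.last (n + 1))) := by
    intro m
    simp only [multiZetaTerm_snoc]
    rw [tsum_mul_left, (hasSum_cpow_add_mul_pow (hd (Fin.last (n + 1))) (hγ (Fin.last (n + 1))) K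
      (powSum_re_pos d' hγ'' m (Fin.last n)) hlast).tsum_eq]
    simp only [multiZetaTerm_mergeLast d' hγ'', mul_add, Finset.mul_sum]
    congr 1
    congr 1
    · rw [← sub_eq_add_neg]; ring
    · exact Finset.sum_congr rfl fun k _ => by ring
  rw [tsum_congr hin, Summable.tsum_add ((s1.mul_left _).add
    (summable_sum fun k _ => (s2 k).mul_left _)) s3,
    Summable.tsum_add (s1.mul_left _) (summable_sum fun k _ => (s2 k).mul_left _),
    Summable.tsum_finsetSum (fun k _ => (s2 k).mul_left _)]
  simp only [tsum_mul_left]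
  rfl

/-! ### Identity theorem, gluing and uniqueness of continuations -/

section Identity
variable {E : Type*} [NormedAddCommGroup E] [NormedSpace ℂ E]

/-- On a ball where h is analytic, a vanishing germ at one point would spread over the whole ball by
the identity theorem. -/
theorem AnalyticAt.eventually_not_eventually_eq_zero {h : E → ℂ} {z : E} (hh : AnalyticAt ℂ h z)
    (h0 : ¬ ∀ᶠ w in 𝓝 z, h w = 0) :
    ∀ᶠ y in 𝓝 z, AnalyticAt ℂ h y ∧ ¬ ∀ᶠ w in 𝓝 y, h w = 0 := by
  obtain ⟨r, hr, hB⟩ := Metric.eventually_nhds_iff_ball.1 hh.eventually_analyticAt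
  filter_upwards [Metric.ball_mem_nhds z hr] with y hy
  refine ⟨hB y hy, fun hy0 => h0 ?_⟩
  filter_upwards [Metric.ball_mem_nhds z hr] with w hw
  exact (show AnalyticOnNhd ℂ h (Metric.ball z r) from hB).eqOn_zero_of_preconnected_of_eventuallyEq_zero
    (convex_ball z r).isPreconnected hy hy0 hw

/-- Germs of analytic functions form an integral domain: near a point where g is nonzero h must
vanish, and this propagates over a ball. -/
theorem AnalyticAt.eventually_eq_zero_of_mul {g h : E → ℂ} {z : E} (hg : AnalyticAt ℂ g z)
    (hh : AnalyticAt ℂ h z) (h0 : ¬ ∀ᶠ w in 𝓝 z, g w = 0) (hgh : ∀ᶠ w in 𝓝 z, g w * h w = 0) :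
    ∀ᶠ w in 𝓝 z, h w = 0 := by
  obtain ⟨r, hr, hB⟩ := Metric.eventually_nhds_iff_ball.1
    (hg.eventually_analyticAt.and (hh.eventually_analyticAt.and hgh))
  obtain ⟨y, hyB, hy⟩ : ∃ y ∈ Metric.ball z r, g y ≠ 0 := by
    by_contra! hcon
    exact h0 (by filter_upwards [Metric.ball_mem_nhds z hr] with w hw using hcon w hw)
  have hy0 : ∀ᶠ w in 𝓝 y, h w = 0 := by
    filter_upwards [(hB y hyB).1.continuousAt.eventually_ne hy,
      Metric.isOpen_ball.mem_nhds hyB] with w hw hwB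
    exact (mul_eq_zero.1 (hB w hwB).2.2).resolve_left hw
  filter_upwards [Metric.ball_mem_nhds z hr] with w hw
  exact (show AnalyticOnNhd ℂ h (Metric.ball z r) from fun x hx =>
    (hB x hx).2.1).eqOn_zero_of_preconnected_of_eventuallyEq_zero
    (convex_ball z r).isPreconnected hyB hy0 hw

theorem AnalyticOnNhd.not_eventually_eq_zero {h : E → ℂ} (hh : AnalyticOnNhd ℂ h Set.univ) {p : E}
    (hp : h p ≠ 0) (z : E) : ¬ ∀ᶠ w in 𝓝 z, h w = 0 := fun h0 =>
  hp (hh.eqOn_zero_of_preconnected_of_eventuallyEq_zero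
    (convex_univ (𝕜 := ℝ)).isPreconnected (Set.mem_univ z) h0 (Set.mem_univ p))

end Identity

/-- Fractions continuing the same function agree on the intersection of their domains. -/
theorem mul_eq_mul_of_fractions {n : ℕ} {D U V : Set (Fin n → ℂ)} (hD : IsOpen D)
    (hD0 : D.Nonempty) (hU : Convex ℝ U) (hV : Convex ℝ V) (hDU : D ⊆ U) (hDV : D ⊆ V)
    {f G₁ H₁ G₂ H₂ : (Fin n → ℂ) → ℂ} (hG₁ : AnalyticOnNhd ℂ G₁ U) (hG₂ : AnalyticOnNhd ℂ G₂ V)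
    (hH₁ : AnalyticOnNhd ℂ H₁ Set.univ) (hH₂ : AnalyticOnNhd ℂ H₂ Set.univ)
    (h₁ : ∀ s ∈ D, H₁ s * f s = G₁ s) (h₂ : ∀ s ∈ D, H₂ s * f s = G₂ s) :
    ∀ s ∈ U ∩ V, G₁ s * H₂ s = G₂ s * H₁ s := by
  obtain ⟨s₀, hs₀⟩ := hD0
  have hA : AnalyticOnNhd ℂ (fun s => G₁ s * H₂ s) (U ∩ V) := fun s hs =>
    (hG₁ s hs.1).mul (hH₂ s (Set.mem_univ _))
  have hB : AnalyticOnNhd ℂ (fun s => G₂ s * H₁ s) (U ∩ V) := fun s hs =>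
    (hG₂ s hs.2).mul (hH₁ s (Set.mem_univ _))
  refine hA.eqOn_of_preconnected_of_eventuallyEq hB (hU.inter hV).isPreconnected
    ⟨hDU hs₀, hDV hs₀⟩ ?_
  filter_upwards [hD.mem_nhds hs₀] with s hs
  rw [← h₁ s hs, ← h₂ s hs]
  ring

/-- Fractions on an exhaustion by convex open sets glue to a meromorphic function. -/
theorem exists_isMeromorphicSeveral {n : ℕ} {D : Set (Fin n → ℂ)} (hD : IsOpen D)
    (hD0 : D.Nonempty) {Ω : ℕ → Set (Fin n → ℂ)} (hΩo : ∀ L, IsOpen (Ω L))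
    (hΩ : ∀ L, Convex ℝ (Ω L)) (hDΩ : ∀ L, D ⊆ Ω L) (hcov : ∀ s, ∃ L, s ∈ Ω L)
    {f : (Fin n → ℂ) → ℂ} {G H : ℕ → (Fin n → ℂ) → ℂ} (hG : ∀ L, AnalyticOnNhd ℂ (G L) (Ω L))
    (hH : ∀ L, AnalyticOnNhd ℂ (H L) Set.univ) (hH0 : ∀ L, ∃ p, H L p ≠ 0)
    (hf : ∀ L, ∀ s ∈ D, H L s * f s = G L s) :
    ∃ Z : (Fin n → ℂ) → ℂ, IsMeromorphicSeveral Z ∧ ∀ s ∈ D, Z s = f s := by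
  classical
  let Z : (Fin n → ℂ) → ℂ := fun s => if s ∈ D then f s else
    if h : ∃ L, s ∈ Ω L ∧ H L s ≠ 0 then G h.choose s / H h.choose s else 0
  refine ⟨Z, fun z => ?_, fun s hs => if_pos hs⟩
  obtain ⟨L, hL⟩ := hcov z
  obtain ⟨p, hp⟩ := hH0 L
  refine ⟨G L, H L, hG L z hL, hH L z (Set.mem_univ _), (hH L).not_eventually_eq_zero hp z, ?_⟩
  filter_upwards [(hΩo L).mem_nhds hL] with w hw hw0
  by_cases hwD : w ∈ D
  · simp only [Z, if_pos hwD]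
    rw [← hf L w hwD, mul_div_cancel_left₀ _ hw0]
  · have h : ∃ L, w ∈ Ω L ∧ H L w ≠ 0 := ⟨L, hw, hw0⟩
    simp only [Z, if_neg hwD, dif_pos h]
    rw [div_eq_div_iff h.choose_spec.2 hw0]
    exact mul_eq_mul_of_fractions hD hD0 (hΩ _) (hΩ _) (hDΩ _) (hDΩ _) (hG _) (hG _) (hH _) (hH _)
      (hf _) (hf _) w ⟨h.choose_spec.1, hw⟩

/-- A meromorphic function that agrees on a nonempty open set with a fraction whose denominator
does not vanish at `p` is regular at `p`. -/
theorem IsMeromorphicSeveral.hasRegularValueAt {n : ℕ} {Z : (Fin n → ℂ) → ℂ}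
    (hZ : IsMeromorphicSeveral Z) {D Ω : Set (Fin n → ℂ)} (hD : IsOpen D) (hD0 : D.Nonempty)
    (hΩ : Convex ℝ Ω) (hDΩ : D ⊆ Ω) {G H : (Fin n → ℂ) → ℂ} (hG : AnalyticOnNhd ℂ G Ω)
    (hH : AnalyticOnNhd ℂ H Set.univ) (hf : ∀ s ∈ D, H s * Z s = G s) {p : Fin n → ℂ} (hp : p ∈ Ω)
    (hHp : H p ≠ 0) {v : ℂ} (hv : G p = H p * v) : HasRegularValueAt Z p v := by
  -- The points near which H Z = G off a thin analytic set. This set is open, contains D and is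
  -- closed relative to Ω, so it contains the convex, hence connected, set Ω.
  let u : Set (Fin n → ℂ) := {z | ∃ h : (Fin n → ℂ) → ℂ, AnalyticAt ℂ h z ∧
    (¬ ∀ᶠ w in 𝓝 z, h w = 0) ∧ ∀ᶠ w in 𝓝 z, h w ≠ 0 → H w * Z w = G w}
  have huo : IsOpen u := by
    rw [isOpen_iff_mem_nhds]
    rintro z ⟨h, h1, h2, h3⟩
    filter_upwards [h1.eventually_not_eventually_eq_zero h2, eventually_eventually_nhds.2 h3]
      with y hy hy3
    exact ⟨h, hy.1, hy.2, hy3⟩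
  have hsub : Ω ⊆ u := by
    refine hΩ.isPreconnected.subset_of_closure_inter_subset huo ?_ ?_
    · obtain ⟨s, hs⟩ := hD0
      refine ⟨s, hDΩ hs, fun _ => 1, analyticAt_const, fun h => one_ne_zero h.self_of_nhds, ?_⟩
      filter_upwards [hD.mem_nhds hs] with w hw _ using hf w hw
    · rintro z ⟨hzu, hzΩ⟩
      obtain ⟨g, k, hg, hk, hk0, hgk⟩ := hZ z
      refine ⟨k, hk, hk0, ?_⟩
      have hF : AnalyticAt ℂ (fun w => H w * g w - G w * k w) z :=
        ((hH z (Set.mem_univ _)).mul hg).sub ((hG z hzΩ).mul hk)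
      -- Near z, Z = g/k off the zeros of k. If H g - G k were a nonzero germ at z, it would be
      -- nonzero at a nearby y in u; but there its product with h and k vanishes, and neither h nor
      -- k has zero germ.
      have hF0 : ∀ᶠ w in 𝓝 z, H w * g w - G w * k w = 0 := by
        by_contra hcon
        have hev := (hF.eventually_not_eventually_eq_zero hcon).and
          ((hk.eventually_not_eventually_eq_zero hk0).and (eventually_eventually_nhds.2 hgk))
        obtain ⟨y, ⟨h, hh, hh0, hhZ⟩, hy1, hy2, hy3⟩ :=
          ((mem_closure_iff_frequently.1 hzu).and_eventually hev).exists
        refine hy1.2 (hh.eventually_eq_zero_of_mul hy1.1 hh0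
          (hy2.1.eventually_eq_zero_of_mul (hh.mul hy1.1) hy2.2 ?_))
        filter_upwards [hhZ, hy3] with w hw1 hw2
        by_cases e1 : h w = 0
        · simp [e1]
        by_cases e2 : k w = 0
        · simp [e2]
        have e3 := hw1 e1
        rw [hw2 e2] at e3
        have e4 : H w * g w - G w * k w = 0 := by
          rw [← e3]; field_simp; ring
        simp [e4]
      filter_upwards [hgk, hF0] with w hw1 hw2 hw3
      rw [hw1 hw3, ← mul_div_assoc, div_eq_iff hw3]
      linear_combination hw2
  obtain ⟨h, h1, h2, h3⟩ := hsub hp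
  refine ⟨fun w => G w / H w, h, (hG p hp).div (hH p (Set.mem_univ _)) hHp, h1, h2, ?_, ?_⟩
  · filter_upwards [h3, (hH p (Set.mem_univ _)).continuousAt.eventually_ne hHp] with w hw1 hw2 hw3
    rw [eq_div_iff hw2, ← hw1 hw3, mul_comm]
  · simp only [hv]
    rw [mul_div_cancel_left₀ _ hHp]

/-! ### Calculus of fractional continuations -/

/-- `f`, given on `D`, is continued to `Ω` by a fraction of holomorphic functions, whose denominator
has no zeros in `P` and whose values on `P ∩ Ω` are given by `v`. -/
def HasFractionOn {E : Type*} [NormedAddCommGroup E] [NormedSpace ℂ E] (D Ω P : Set E)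
    (f v : E → ℂ) : Prop :=
  ∃ G H : E → ℂ, AnalyticOnNhd ℂ G Ω ∧ AnalyticOnNhd ℂ H Set.univ ∧ (∀ p ∈ P, H p ≠ 0) ∧
    (∀ s ∈ D, H s * f s = G s) ∧ ∀ p ∈ P ∩ Ω, G p = H p * v p

namespace HasFractionOn
variable {E : Type*} [NormedAddCommGroup E] [NormedSpace ℂ E] {D Ω P : Set E} {f g v w : E → ℂ}

theorem of_analyticOnNhd (D P : Set E) (hf : AnalyticOnNhd ℂ f Ω) : HasFractionOn D Ω P f f :=
  ⟨f, fun _ => 1, hf, fun _ _ => analyticAt_const, fun _ _ => one_ne_zero, fun _ _ => one_mul _,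
    fun _ _ => (one_mul _).symm⟩

theorem congr (hf : HasFractionOn D Ω P f v) (h : ∀ s ∈ D, g s = f s) :
    HasFractionOn D Ω P g v := by
  obtain ⟨G, H, h1, h2, h3, h4, h5⟩ := hf
  exact ⟨G, H, h1, h2, h3, fun s hs => by rw [h s hs, h4 s hs], h5⟩

theorem mul (hf : HasFractionOn D Ω P f v) (hg : HasFractionOn D Ω P g w) :
    HasFractionOn D Ω P (fun s => f s * g s) (fun s => v s * w s) := by
  obtain ⟨G₁, H₁, h1, h2, h3, h4, h5⟩ := hf
  obtain ⟨G₂, H₂, k1, k2, k3, k4, k5⟩ := hg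
  refine ⟨fun s => G₁ s * G₂ s, fun s => H₁ s * H₂ s, h1.mul k1, h2.mul k2,
    fun p hp => mul_ne_zero (h3 p hp) (k3 p hp), fun s hs => ?_, fun p hp => ?_⟩
  · simp only [← h4 s hs, ← k4 s hs]; ring
  · simp only [h5 p hp, k5 p hp]; ring

theorem add (hf : HasFractionOn D Ω P f v) (hg : HasFractionOn D Ω P g w) :
    HasFractionOn D Ω P (fun s => f s + g s) (fun s => v s + w s) := by
  obtain ⟨G₁, H₁, h1, h2, h3, h4, h5⟩ := hf
  obtain ⟨G₂, H₂, k1, k2, k3, k4, k5⟩ := hg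
  refine ⟨fun s => G₁ s * H₂ s + G₂ s * H₁ s, fun s => H₁ s * H₂ s,
    (h1.mul fun s _ => k2 s trivial).add (k1.mul fun s _ => h2 s trivial), h2.mul k2,
    fun p hp => mul_ne_zero (h3 p hp) (k3 p hp), fun s hs => ?_, fun p hp => ?_⟩
  · simp only [← h4 s hs, ← k4 s hs]; ring
  · simp only [h5 p hp, k5 p hp]; ring

theorem sum {ι : Type*} (t : Finset ι) {f v : ι → E → ℂ}
    (hf : ∀ i ∈ t, HasFractionOn D Ω P (f i) (v i)) :
    HasFractionOn D Ω P (fun s => ∑ i ∈ t, f i s) (fun s => ∑ i ∈ t, v i s) := by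
  classical
  induction t using Finset.induction_on with
  | empty => simpa using of_analyticOnNhd D P (f := fun _ : E => (0 : ℂ)) fun _ _ => analyticAt_const
  | insert a t ha ih =>
    simp only [Finset.sum_insert ha]
    exact (hf a (Finset.mem_insert_self a t)).add
      (ih fun i hi => hf i (Finset.mem_insert_of_mem hi))

theorem comp {F : Type*} [NormedAddCommGroup F] [NormedSpace ℂ F] {D' Ω' P' : Set F} {τ : F → E}
    (hf : HasFractionOn D Ω P f v) (hτ : AnalyticOnNhd ℂ τ Set.univ) (hD : Set.MapsTo τ D' D)
    (hΩ : Set.MapsTo τ Ω' Ω) (hP : Set.MapsTo τ P' P) :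
    HasFractionOn D' Ω' P' (fun s => f (τ s)) (fun s => v (τ s)) := by
  obtain ⟨G, H, h1, h2, h3, h4, h5⟩ := hf
  exact ⟨fun s => G (τ s), fun s => H (τ s), fun s hs => (h1 _ (hΩ hs)).fun_comp (hτ s trivial),
    fun s _ => (h2 _ trivial).fun_comp (hτ s trivial), fun p hp => h3 _ (hP hp),
    fun s hs => h4 _ (hD hs), fun p hp => h5 _ ⟨hP hp.1, hΩ hp.2⟩⟩

end HasFractionOn

/-- `ζ(w) (w - 1)` as an entire function. -/
theorem differentiable_update_sub_one_mul_riemannZeta :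
    Differentiable ℂ (Function.update (fun w : ℂ => (w - 1) * riemannZeta w) 1 1) := by
  rw [← differentiableOn_univ,
    ← Complex.differentiableOn_compl_singleton_and_continuousAt_iff (c := 1) Filter.univ_mem]
  refine ⟨DifferentiableOn.congr (f := fun w : ℂ => (w - 1) * riemannZeta w)
    (fun w hw => ?_) fun w hw => Function.update_of_ne hw.2 _ _,
    continuousWithinAt_compl_self.mp ?_⟩
  · exact ((differentiableAt_id.sub_const 1).mul
      (differentiableAt_riemannZeta hw.2)).differentiableWithinAt
  · simpa [continuousWithinAt_compl_self] using riemannZeta_residue_one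

/-! ### The exhausting regions and the points avoiding poles -/

/-- The half-space region `Re (s_j + ⋯ + s_n) > -L` for all `j`. -/
def tailRegion (n L : ℕ) : Set (Fin n → ℂ) := {s | ∀ j, -(L : ℝ) < (∑ i ∈ Finset.Ici j, s i).re}

theorem isOpen_tailRegion (n L : ℕ) : IsOpen (tailRegion n L) := by
  have : tailRegion n L = ⋂ j, {s : Fin n → ℂ | -(L : ℝ) < (∑ i ∈ Finset.Ici j, s i).re} := by
    ext s; simp [tailRegion]
  rw [this]
  exact isOpen_iInter_of_finite fun j => isOpen_lt continuous_const (by fun_prop)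

theorem convex_tailRegion (n L : ℕ) : Convex ℝ (tailRegion n L) := by
  intro s hs t ht a b ha hb hab j
  have h1 := hs j
  have h2 := ht j
  have h3 : (∑ i ∈ Finset.Ici j, (a • s + b • t) i).re
      = a * (∑ i ∈ Finset.Ici j, s i).re + b * (∑ i ∈ Finset.Ici j, t i).re := by
    simp [Finset.sum_add_distrib, Finset.mul_sum]
  rw [h3]
  have h4 : -(L : ℝ) = a * -(L : ℝ) + b * -(L : ℝ) := by rw [← add_mul, hab, one_mul]
  rw [h4]
  rcases ha.eq_or_lt with rfl | ha
  · have hb1 : b = 1 := by linarith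
    subst hb1
    simpa using h2
  · exact add_lt_add_of_lt_of_le (mul_lt_mul_of_pos_left h1 ha) (mul_le_mul_of_nonneg_left h2.le hb)

theorem multiZetaDomain_subset_tailRegion {n : ℕ} (d : Fin n → ℕ) (L : ℕ) :
    multiZetaDomain d ⊆ tailRegion n L := by
  intro s hs j
  have h1 : 0 ≤ ∑ i ∈ Finset.Ici j, (1 / (d i : ℝ)) := Finset.sum_nonneg fun i _ => by positivity
  have h2 : (0 : ℝ) ≤ L := by positivity
  have := hs j
  linarith

theorem exists_mem_tailRegion {n : ℕ} (s : Fin n → ℂ) : ∃ L, s ∈ tailRegion n L := by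
  obtain ⟨L, hL⟩ := exists_nat_gt (∑ j, |(∑ i ∈ Finset.Ici j, s i).re|)
  refine ⟨L, fun j => ?_⟩
  have h1 := Finset.single_le_sum (f := fun j => |(∑ i ∈ Finset.Ici j, s i).re|)
    (fun _ _ => abs_nonneg _) (Finset.mem_univ j)
  have h2 := neg_abs_le (∑ i ∈ Finset.Ici j, s i).re
  linarith

/-- `x` avoids all the numbers `1/d_j + ∑_{k > j} ε_k/d_k` modulo `ℤ`. -/
def AvoidsPoles {n : ℕ} (d : Fin n → ℕ) (x : ℂ) : Prop :=
  ∀ (j : Fin n) (ε : Fin n → ℕ), (∀ k, ε k = 0 ∨ ε k = 1) → ∀ N : ℤ,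
    x ≠ 1 / d j + ∑ k ∈ Finset.Ioi j, (ε k : ℂ) / d k + N

/-- The points `(0, …, 0, x)` with `x` avoiding the poles. -/
def regularPoints {n : ℕ} (d : Fin (n + 1) → ℕ) : Set (Fin (n + 1) → ℂ) :=
  {s | ∃ x, AvoidsPoles d x ∧ s = Pi.single (Fin.last n) x}

theorem sum_Ioi_castSucc_fin {M : Type*} [AddCommMonoid M] {n : ℕ} (f : Fin (n + 1) → M)
    (j : Fin n) : ∑ i ∈ Finset.Ioi j.castSucc, f i
      = ∑ i ∈ Finset.Ioi j, f i.castSucc + f (Fin.last n) := by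
  have h1 : Finset.Ioi j.castSucc = Finset.univ.filter (j.castSucc < ·) := by ext; simp
  have h2 : Finset.Ioi j = Finset.univ.filter (j < ·) := by ext; simp
  rw [h1, h2, Finset.sum_filter, Finset.sum_filter, Fin.sum_univ_castSucc]
  simp [Fin.castSucc_lt_last]

theorem AvoidsPoles.last {n : ℕ} {d : Fin (n + 1) → ℕ} {x : ℂ} (hx : AvoidsPoles d x) (N : ℤ) :
    x ≠ 1 / d (Fin.last n) + N := by
  have h := hx (Fin.last n) 0 (fun k => Or.inl rfl) N
  simpa using h

/-- Covers both shifts in the recursion: e = 1 for the Gamma term and e = 0 for the terms A^(-s-k).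
The digit e becomes the last ε, which is how these sums accumulate. -/
theorem AvoidsPoles.shift {n : ℕ} {d : Fin (n + 2) → ℕ} {x : ℂ} (hx : AvoidsPoles d x) {e : ℕ}
    (he : e = 0 ∨ e = 1) (k : ℤ) :
    AvoidsPoles (fun i => d i.castSucc) (x - (e : ℂ) / d (Fin.last (n + 1)) + k) := by
  intro j ε hε N h
  refine hx j.castSucc (Fin.snoc (α := fun _ => ℕ) ε e) (fun i => ?_) (N - k) ?_
  · refine Fin.lastCases ?_ (fun i => ?_) i
    · simpa using he
    · simpa using hε i
  · rw [sum_Ioi_castSucc_fin]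
    simp only [Fin.snoc_castSucc, Fin.snoc_last]
    push_cast
    linear_combination h

/-- The family of points (0,…,0,x) is stable under the recursion, so only the number x has to be
tracked. -/
theorem mergeLast_single {n : ℕ} (w x : ℂ) :
    mergeLast w (Pi.single (Fin.last (n + 1)) x : Fin (n + 2) → ℂ)
      = Pi.single (Fin.last n) (x + w) := by
  ext j
  simp [mergeLast, Pi.single_apply, Fin.castSucc_ne_last]

theorem analyticAt_coordinate {n : ℕ} (i : Fin n) (s : Fin n → ℂ) :
    AnalyticAt ℂ (fun s : Fin n → ℂ => s i) s :=
  (ContinuousLinearMap.proj (R := ℂ) (φ := fun _ : Fin n => ℂ) i).analyticAt s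

theorem analyticOnNhd_mergeLast {n : ℕ} (w : ℂ) :
    AnalyticOnNhd ℂ (mergeLast w : (Fin (n + 2) → ℂ) → Fin (n + 1) → ℂ) Set.univ := by
  intro s _
  refine AnalyticAt.pi fun j => ?_
  unfold mergeLast
  split_ifs
  · exact (analyticAt_coordinate _ s).add
      ((analyticAt_coordinate _ s).add analyticAt_const)
  · exact (analyticAt_coordinate _ s).add analyticAt_const

theorem mergeLast_mem_tailRegion {n L : ℕ} {s : Fin (n + 2) → ℂ} (hs : s ∈ tailRegion (n + 2) L)
    {w : ℂ} (hw : -1 ≤ w.re) : mergeLast w s ∈ tailRegion (n + 1) (L + 1) := by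
  intro j
  have := hs j.castSucc
  rw [sum_Ici_mergeLast, Complex.add_re]
  push_cast
  linarith

/-- Tail sums exceed -L and the sums of the 1/d_i are at most n + 1, so K = L + n + 1 suffices. -/
theorem tailRegion_subset_multiZetaRemDomain {n : ℕ} {d : Fin (n + 2) → ℕ} (hd : ∀ j, 1 ≤ d j)
    (L : ℕ) : tailRegion (n + 2) L ⊆ multiZetaRemDomain d (L + n + 1) := by
  intro s hs
  refine ⟨?_, fun j => ?_⟩
  · have := hs (Fin.last (n + 1))
    rw [sum_Ici_last_fin] at this
    refine lt_of_le_of_lt ?_ this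
    push_cast
    linarith [n.cast_nonneg (α := ℝ)]
  · have h1 := hs j.castSucc
    have h2 : ∑ i ∈ Finset.Ici j, (1 / (d i.castSucc : ℝ)) ≤ n + 1 := by
      calc ∑ i ∈ Finset.Ici j, (1 / (d i.castSucc : ℝ)) ≤ ∑ i ∈ Finset.Ici j, (1 : ℝ) := by
            refine Finset.sum_le_sum fun i _ => ?_
            have := hd i.castSucc
            have h3 : (1 : ℝ) ≤ d i.castSucc := by exact_mod_cast this
            exact div_le_one_of_le₀ h3 (by linarith)
        _ ≤ ∑ i : Fin (n + 1), (1 : ℝ) :=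
            Finset.sum_le_sum_of_subset_of_nonneg (Finset.subset_univ _) fun _ _ _ => zero_le_one
        _ = _ := by simp
    rw [sum_Ici_mergeLast, Complex.add_re, Complex.natCast_re]
    push_cast
    linarith

/-- Γ(z) = Γ(z+L+1)/(z(z+1)⋯(z+L)) with z = s_n - 1/d_n, where Re z > -L-1. The value is left
unspecified: at the points of interest it is multiplied by 1/Γ(-N) = 0. -/
theorem hasFractionOn_Gamma {n : ℕ} (d : Fin (n + 1) → ℕ) (hd : 1 ≤ d (Fin.last n)) (L : ℕ) :
    ∃ v, HasFractionOn (multiZetaDomain d) (tailRegion (n + 1) L) (regularPoints d)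
      (fun s => Complex.Gamma (s (Fin.last n) - 1 / d (Fin.last n))) v := by
  let H : (Fin (n + 1) → ℂ) → ℂ := fun s =>
    ∏ i ∈ Finset.range (L + 1), (s (Fin.last n) - 1 / d (Fin.last n) + i)
  let G : (Fin (n + 1) → ℂ) → ℂ := fun s =>
    Complex.Gamma (s (Fin.last n) - 1 / d (Fin.last n) + (L + 1 : ℕ))
  have hre : (1 / d (Fin.last n) : ℂ).re = 1 / (d (Fin.last n) : ℝ) := by
    have : (1 / d (Fin.last n) : ℂ) = ((1 / d (Fin.last n) : ℝ) : ℂ) := by push_cast; rfl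
    rw [this, Complex.ofReal_re]
  have hH0 : ∀ p ∈ regularPoints d, H p ≠ 0 := by
    rintro p ⟨x, hx, rfl⟩
    refine Finset.prod_ne_zero_iff.2 fun i _ h => hx.last (-i) ?_
    rw [Pi.single_eq_same] at h
    push_cast
    linear_combination h
  refine ⟨fun s => G s / H s, G, H, fun s hs => ?_, fun s _ => ?_, hH0, fun s hs => ?_,
    fun p hp => ?_⟩
  · have h1 : AnalyticAt ℂ Complex.Gamma
        (s (Fin.last n) - 1 / d (Fin.last n) + (L + 1 : ℕ)) := by
      refine DifferentiableOn.analyticAt (s := {z | 0 < z.re}) (fun z hz => ?_)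
        ((isOpen_lt continuous_const Complex.continuous_re).mem_nhds ?_)
      · refine (Complex.differentiableAt_Gamma z fun m h => ?_).differentiableWithinAt
        have hz : 0 < z.re := hz
        rw [h, Complex.neg_re, Complex.natCast_re] at hz
        linarith [m.cast_nonneg (α := ℝ)]
      · have h2 := hs (Fin.last n)
        rw [sum_Ici_last_fin] at h2
        have h3 : 1 / (d (Fin.last n) : ℝ) ≤ 1 := by
          have : (1 : ℝ) ≤ d (Fin.last n) := by exact_mod_cast hd
          exact div_le_one_of_le₀ this (by linarith)
        change 0 < (s (Fin.last n) - 1 / d (Fin.last n) + (L + 1 : ℕ)).re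
        rw [Complex.add_re, Complex.sub_re, hre, Complex.natCast_re]
        push_cast
        linarith
    exact AnalyticAt.fun_comp (f := fun s : Fin (n + 1) → ℂ =>
      s (Fin.last n) - 1 / d (Fin.last n) + (L + 1 : ℕ)) h1
      (((analyticAt_coordinate _ s).sub analyticAt_const).add analyticAt_const)
  · exact Finset.analyticAt_fun_prod _ fun i _ =>
      ((analyticAt_coordinate _ s).sub analyticAt_const).add analyticAt_const
  · have h2 := hs (Fin.last n)
    rw [sum_Ici_last_fin, sum_Ici_last_fin] at h2
    exact (Complex.Gamma_add_natCast (by rw [Complex.sub_re, hre]; linarith) (L + 1)).symm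
  · rw [mul_div_cancel₀ _ (hH0 p hp.1)]

/-! ### Continuation and values by induction on the number of variables -/

/-- The values at `(0, …, 0, -N)` given by the recursion over the number of variables. -/
noncomputable def multiZetaVal : (n : ℕ) → (Fin (n + 1) → ℕ) → (Fin (n + 1) → ℂ) → ℕ → ℂ
  | 0, d, γ, N => γ 0 ^ N * riemannZeta (-(d 0 * N : ℕ))
  | n + 1, d, γ, N => ∑ k ∈ Finset.range (N + 1),
      powThetaCoeff (d (Fin.last (n + 1))) (γ (Fin.last (n + 1))) k
        * (∏ i ∈ Finset.range k, (-(N : ℂ) + i))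
        * multiZetaVal n (fun i => d i.castSucc) (fun i => γ i.castSucc) (N - k)

/-- The principal power splits as (γ x)^(-s) = γ^(-s) x^(-s) because x = m^d is a positive real. -/
theorem multiZetaSum_one {d : Fin 1 → ℕ} (hd : ∀ j, 1 ≤ d j) {γ : Fin 1 → ℂ}
    (hγ : ∀ j, 0 < (γ j).re) {s : Fin 1 → ℂ} (hs : s ∈ multiZetaDomain d) :
    multiZetaSum d γ s = γ 0 ^ (-s 0) * riemannZeta (d 0 * s 0) := by
  have hd0 : (0 : ℝ) < d 0 := by exact_mod_cast hd 0
  have h0 := hs (Fin.last 0)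
  rw [sum_Ici_last_fin, sum_Ici_last_fin] at h0
  have hre : 1 < ((d 0 : ℂ) * s 0).re := by
    have h1 : ((d 0 : ℂ) * s 0).re = d 0 * (s 0).re := by
      rw [← Complex.ofReal_natCast, Complex.re_ofReal_mul]
    rw [h1]
    have h2 : 1 / (d 0 : ℝ) < (s 0).re := h0
    rwa [div_lt_iff₀' hd0] at h2
  let e : ℕ ≃ (Fin 1 → ℕ+) := Equiv.pnatEquivNat.symm.trans (Equiv.funUnique (Fin 1) ℕ+).symm
  have hγ0 : γ 0 ≠ 0 := fun h => by simpa [h] using hγ 0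
  rw [multiZetaSum, ← e.tsum_eq, zeta_eq_tsum_one_div_nat_add_one_cpow hre, ← tsum_mul_left]
  refine tsum_congr fun m => ?_
  have h2 : Finset.Iic (0 : Fin 1) = {0} := rfl
  have h3 : multiZetaTerm d γ s (e m) = (γ 0 * ((((m : ℝ) + 1) ^ d 0 : ℝ) : ℂ)) ^ (-s 0) := by
    simp [multiZetaTerm_eq_prod, powSum, h2, e, Equiv.pnatEquivNat]
  have hm : (0 : ℝ) < (m : ℝ) + 1 := by positivity
  have hm0 : ((m : ℂ) + 1) ≠ 0 := by exact_mod_cast m.succ_ne_zero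
  have h4 : γ 0 * ((((m : ℝ) + 1) ^ d 0 : ℝ) : ℂ) ≠ 0 :=
    mul_ne_zero hγ0 (Complex.ofReal_ne_zero.2 (by positivity))
  have h5 : (Real.log ((m : ℝ) + 1) : ℂ) = Complex.log ((m : ℂ) + 1) := by
    rw [Complex.ofReal_log hm.le]; push_cast; rfl
  rw [h3, Complex.cpow_def_of_ne_zero h4, Complex.log_mul_ofReal _ (by positivity) _ hγ0,
    Real.log_pow, one_div, ← Complex.cpow_neg, Complex.cpow_def_of_ne_zero hγ0,
    Complex.cpow_def_of_ne_zero hm0, ← Complex.exp_add, Complex.ofReal_mul, h5]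
  congr 1
  push_cast
  ring

/-- Every ingredient of the recursion `multiZetaSum_eq` is a fraction whose denominator is nonzero
at the regular points, and such fractions are closed under sums, products and substitutions. -/
theorem exists_hasFractionOn_multiZetaSum (n : ℕ) {d : Fin (n + 1) → ℕ} (hd : ∀ j, 1 ≤ d j)
    {γ : Fin (n + 1) → ℂ} (hγ : ∀ j, 0 < (γ j).re) (L : ℕ) :
    ∃ v, HasFractionOn (multiZetaDomain d) (tailRegion (n + 1) L) (regularPoints d)
      (multiZetaSum d γ) v ∧
      ∀ N : ℕ, N < L → v (Pi.single (Fin.last n) (-N)) = multiZetaVal n d γ N := by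
  induction n generalizing L with
  | zero =>
    have hγ0 : γ 0 ≠ 0 := fun h => by simpa [h] using hγ 0
    have hd0 : (d 0 : ℂ) ≠ 0 := by have := hd 0; exact_mod_cast (by omega : d 0 ≠ 0)
    have h1 : HasFractionOn (multiZetaDomain d) (tailRegion 1 L) (regularPoints d)
        (fun s => γ 0 ^ (-s 0)) (fun s => γ 0 ^ (-s 0)) := by
      refine HasFractionOn.of_analyticOnNhd _ _ fun s _ => ?_
      have h2 : (fun s : Fin 1 → ℂ => γ 0 ^ (-s 0))
          = fun s => Complex.exp (Complex.log (γ 0) * -s 0) := by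
        ext s; rw [Complex.cpow_def_of_ne_zero hγ0]
      rw [h2]
      exact (analyticAt_const.mul (analyticAt_coordinate _ s).neg).cexp
    have h3 : HasFractionOn (multiZetaDomain d) (tailRegion 1 L) (regularPoints d)
        (fun s => riemannZeta (d 0 * s 0)) (fun s => riemannZeta (d 0 * s 0)) := by
      have hlin : AnalyticOnNhd ℂ (fun s : Fin 1 → ℂ => (d 0 : ℂ) * s 0) Set.univ := fun s _ =>
        analyticAt_const.mul (analyticAt_coordinate _ s)
      refine ⟨fun s => Function.update (fun w : ℂ => (w - 1) * riemannZeta w) 1 1 (d 0 * s 0),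
        fun s => d 0 * s 0 - 1, fun s _ => ?_, fun s _ => (hlin s trivial).sub analyticAt_const,
        ?_, fun s hs => ?_, fun p hp => ?_⟩
      · exact AnalyticAt.fun_comp (f := fun s : Fin 1 → ℂ => (d 0 : ℂ) * s 0)
          (differentiable_update_sub_one_mul_riemannZeta.analyticAt _) (hlin s trivial)
      · rintro p ⟨x, hx, rfl⟩ h
        refine hx.last 0 ?_
        change x = 1 / (d 0 : ℂ) + ((0 : ℤ) : ℂ)
        have h : (d 0 : ℂ) * x - 1 = 0 := h
        rw [Int.cast_zero, add_zero]
        exact eq_div_of_mul_eq hd0 (by linear_combination h)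
      · have hne : (d 0 : ℂ) * s 0 ≠ 1 := by
          intro h
          have h0 := hs (Fin.last 0)
          rw [sum_Ici_last_fin, sum_Ici_last_fin] at h0
          have h4 : s 0 = ((1 / d 0 : ℝ) : ℂ) := by
            push_cast
            exact eq_div_of_mul_eq hd0 (by linear_combination h)
          have h0 : 1 / (d 0 : ℝ) < (s 0).re := h0
          rw [h4, Complex.ofReal_re] at h0
          exact lt_irrefl _ h0
        simp only [Function.update_of_ne hne]
      · obtain ⟨x, hx, rfl⟩ := hp.1
        have hne : (d 0 : ℂ) * (Pi.single (Fin.last 0) x : Fin 1 → ℂ) 0 ≠ 1 := by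
          intro h
          refine hx.last 0 ?_
          change x = 1 / (d 0 : ℂ) + ((0 : ℤ) : ℂ)
          have h : (d 0 : ℂ) * x = 1 := h
          rw [Int.cast_zero, add_zero]
          exact eq_div_of_mul_eq hd0 (by linear_combination h)
        simp only [Function.update_of_ne hne]
    refine ⟨_, (h1.mul h3).congr fun s hs => multiZetaSum_one hd hγ hs, fun N _ => ?_⟩
    have h4 : (Pi.single (Fin.last 0) (-N : ℂ) : Fin 1 → ℂ) 0 = -N := rfl
    simp only [h4, multiZetaVal, neg_neg, Complex.cpow_natCast]
    push_cast
    rw [mul_neg]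
  | succ n ih =>
    -- Merging shifts tail sums by at least -1/d ≥ -1, so a region with parameter L lands in one
    -- with parameter L + 1.
    obtain ⟨v, hv, hvN⟩ := ih (d := fun i => d i.castSucc) (γ := fun i => γ i.castSucc)
      (fun j => hd _) (fun j => hγ _) (L + 1)
    obtain ⟨vΓ, hvΓ⟩ := hasFractionOn_Gamma d (hd _) L
    have hre : (-(1 / d (Fin.last (n + 1))) : ℂ).re = -(1 / (d (Fin.last (n + 1)) : ℝ)) := by
      have : (1 / d (Fin.last (n + 1)) : ℂ) = ((1 / d (Fin.last (n + 1)) : ℝ) : ℂ) := by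
        push_cast; rfl
      rw [Complex.neg_re, this, Complex.ofReal_re]
    have hdl : 1 / (d (Fin.last (n + 1)) : ℝ) ≤ 1 := by
      have : (1 : ℝ) ≤ d (Fin.last (n + 1)) := by exact_mod_cast hd _
      exact div_le_one_of_le₀ this (by linarith)
    have hdl0 : 0 ≤ 1 / (d (Fin.last (n + 1)) : ℝ) := by positivity
    have hshift : HasFractionOn (multiZetaDomain d) (tailRegion (n + 2) L) (regularPoints d)
        (fun s => multiZetaSum (fun i => d i.castSucc) (fun i => γ i.castSucc)
          (mergeLast (-(1 / d (Fin.last (n + 1)))) s))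
        (fun s => v (mergeLast (-(1 / d (Fin.last (n + 1)))) s)) := by
      refine hv.comp (analyticOnNhd_mergeLast _)
        (fun s hs => mergeLast_mem_multiZetaDomain hs hre.ge)
        (fun s hs => mergeLast_mem_tailRegion hs (by rw [hre]; linarith)) ?_
      rintro p ⟨x, hx, rfl⟩
      refine ⟨_, ?_, mergeLast_single _ _⟩
      simpa [sub_eq_add_neg] using hx.shift (Or.inr rfl) 0
    have hshiftk : ∀ k : ℕ, HasFractionOn (multiZetaDomain d) (tailRegion (n + 2) L)
        (regularPoints d)
        (fun s => multiZetaSum (fun i => d i.castSucc) (fun i => γ i.castSucc)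
          (mergeLast (k : ℂ) s)) (fun s => v (mergeLast (k : ℂ) s)) := by
      intro k
      have hk : (0 : ℝ) ≤ k := k.cast_nonneg
      refine hv.comp (analyticOnNhd_mergeLast _)
        (fun s hs => mergeLast_mem_multiZetaDomain hs (by rw [Complex.natCast_re]; linarith))
        (fun s hs => mergeLast_mem_tailRegion hs (by rw [Complex.natCast_re]; linarith)) ?_
      rintro p ⟨x, hx, rfl⟩
      refine ⟨_, ?_, mergeLast_single _ _⟩
      simpa using hx.shift (Or.inl rfl) k
    have hrem : HasFractionOn (multiZetaDomain d) (tailRegion (n + 2) L) (regularPoints d)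
        (multiZetaRem d γ (L + n + 1)) (multiZetaRem d γ (L + n + 1)) :=
      HasFractionOn.of_analyticOnNhd _ _ fun s hs =>
        analyticOnNhd_multiZetaRem hd hγ _ s (tailRegion_subset_multiZetaRemDomain hd L hs)
    have hconst : ∀ c : ℂ, HasFractionOn (multiZetaDomain d) (tailRegion (n + 2) L)
        (regularPoints d) (fun _ => c) (fun _ => c) := fun c =>
      HasFractionOn.of_analyticOnNhd _ _ fun _ _ => analyticAt_const
    have hΓi : HasFractionOn (multiZetaDomain d) (tailRegion (n + 2) L) (regularPoints d)
        (fun s => (Complex.Gamma (s (Fin.last (n + 1))))⁻¹)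
        (fun s => (Complex.Gamma (s (Fin.last (n + 1))))⁻¹) :=
      HasFractionOn.of_analyticOnNhd _ _ fun s _ =>
        AnalyticAt.fun_comp (f := fun s : Fin (n + 2) → ℂ => s (Fin.last (n + 1)))
          (Complex.differentiable_one_div_Gamma.analyticAt _) (analyticAt_coordinate _ s)
    have hpoly : ∀ k : ℕ, HasFractionOn (multiZetaDomain d) (tailRegion (n + 2) L)
        (regularPoints d) (fun s => ∏ i ∈ Finset.range k, (s (Fin.last (n + 1)) + i))
        (fun s => ∏ i ∈ Finset.range k, (s (Fin.last (n + 1)) + i)) := fun k =>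
      HasFractionOn.of_analyticOnNhd _ _ fun s _ => Finset.analyticAt_fun_prod _ fun i _ =>
        (analyticAt_coordinate _ s).add analyticAt_const
    refine ⟨_, (((((hconst _).mul (hvΓ.mul hΓi)).mul hshift).add
      (HasFractionOn.sum (Finset.range (L + n + 1)) fun k _ =>
        ((hconst (powThetaCoeff (d (Fin.last (n + 1))) (γ (Fin.last (n + 1))) k)).mul
          (hpoly k)).mul (hshiftk k))).add hrem).congr fun s hs =>
            multiZetaSum_eq hd hγ (L + n + 1) hs, fun N hN => ?_⟩
    have h1 : (Pi.single (Fin.last (n + 1)) (-N : ℂ) : Fin (n + 2) → ℂ) (Fin.last (n + 1)) = -N :=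
      Pi.single_eq_same _ _
    simp only [h1, multiZetaRem_eq_zero d γ _ N h1, Complex.Gamma_neg_nat_eq_zero, inv_zero,
      mul_zero, zero_mul, zero_add, add_zero, multiZetaVal, mergeLast_single]
    symm
    -- The terms with N < k ≤ L + n vanish: their rising factorial contains the factor -N + N.
    refine (Finset.sum_congr rfl fun k hk => ?_).trans (Finset.sum_subset
      (Finset.range_subset_range.2 (by omega : N + 1 ≤ L + n + 1)) fun k _ hk => ?_)
    · rw [← hvN (N - k) (by omega), Nat.cast_sub (by have := Finset.mem_range.1 hk; omega)]
      congr 3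
      ring
    · have h2 : ∏ i ∈ Finset.range k, (-(N : ℂ) + i) = 0 :=
        Finset.prod_eq_zero (i := N) (Finset.mem_range.2 (by
          have := mt Finset.mem_range.2 hk; omega)) (by ring)
      rw [h2, mul_zero, zero_mul]

theorem multiZetaDomain_nonempty {n : ℕ} (d : Fin n → ℕ) : (multiZetaDomain d).Nonempty := by
  refine ⟨fun i => ((1 / (d i : ℝ) + 1 : ℝ) : ℂ), mem_multiZetaDomain_iff.2 fun j => ?_⟩
  refine Finset.sum_lt_sum_of_nonempty ⟨j, Finset.mem_Ici.2 le_rfl⟩ fun i _ => ?_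
  rw [Complex.ofReal_re]
  linarith

/-- The sums are positive, so an integral one would be a positive integer; excluding those already
excludes all integers. -/
theorem NonIntegralSums.avoidsPoles {n : ℕ} {d : Fin n → ℕ} (hd : ∀ j, 1 ≤ d j)
    (h : NonIntegralSums d) (N : ℕ) : AvoidsPoles d (-(N : ℂ)) := by
  intro j ε hε M hM
  have h1 : (1 / (d j : ℚ) + ∑ k ∈ Finset.Ioi j, (ε k : ℚ) / (d k : ℚ)) = ((-N - M : ℤ) : ℚ) := by
    have h2 : (1 / (d j : ℂ) + ∑ k ∈ Finset.Ioi j, (ε k : ℂ) / (d k : ℂ)) = -N - M := by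
      linear_combination -hM
    apply Rat.cast_injective (α := ℂ)
    push_cast
    exact h2
  have hpos : (0 : ℚ) < 1 / (d j : ℚ) + ∑ k ∈ Finset.Ioi j, (ε k : ℚ) / (d k : ℚ) := by
    have h3 : (0 : ℚ) < d j := by exact_mod_cast hd j
    exact add_pos_of_pos_of_nonneg (by positivity) (Finset.sum_nonneg fun k _ => by positivity)
  rw [h1] at hpos
  have hpos' : 0 < -(N : ℤ) - M := by exact_mod_cast hpos
  obtain ⟨K, hK⟩ := Int.eq_ofNat_of_zero_le hpos'.le
  refine h j ε hε K (by omega) ?_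
  rw [h1, hK]
  rfl

/-! ### Solving the recursion for N = 0, 1, 2 -/

theorem sum_Ioo_castSucc_fin {M : Type*} [AddCommMonoid M] {n : ℕ} (f : Fin (n + 2) → M)
    (k : Fin (n + 1)) :
    ∑ i ∈ Finset.Ioo 0 k.castSucc, f i = ∑ i ∈ Finset.Ioo 0 k, f i.castSucc := by
  have h1 : Finset.Ioo 0 k.castSucc = Finset.univ.filter (fun i => 0 < i ∧ i < k.castSucc) := by
    ext; simp
  have h2 : Finset.Ioo 0 k = Finset.univ.filter (fun i => 0 < i ∧ i < k) := by ext; simp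
  rw [h1, h2, Finset.sum_filter, Finset.sum_filter, Fin.sum_univ_castSucc]
  have h3 : ¬ Fin.last (n + 1) < k.castSucc := (Fin.le_last _).not_gt
  simp [h3]

theorem sum_Ioo_last_fin {M : Type*} [AddCommMonoid M] {n : ℕ} (f : Fin (n + 2) → M) :
    ∑ i ∈ Finset.Ioo 0 (Fin.last (n + 1)), f i
      = ∑ i ∈ Finset.Ioi (0 : Fin (n + 1)), f i.castSucc := by
  have h1 : Finset.Ioo 0 (Fin.last (n + 1))
      = Finset.univ.filter (fun i => 0 < i ∧ i < Fin.last (n + 1)) := by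
    ext; simp
  have h2 : Finset.Ioi (0 : Fin (n + 1)) = Finset.univ.filter (fun i => 0 < i) := by ext; simp
  rw [h1, h2, Finset.sum_filter, Finset.sum_filter, Fin.sum_univ_castSucc]
  simp [Fin.castSucc_lt_last]

theorem riemannZeta_neg_eq_neg_bernoulli {a : ℕ} (ha : 1 ≤ a) :
    riemannZeta (-a) = -((bernoulli (a + 1) : ℂ) / ((a : ℂ) + 1)) := by
  rw [riemannZeta_neg_nat_eq_bernoulli', bernoulli_eq_bernoulli'_of_ne_one (by omega), neg_div]

theorem multiZetaVal_zero (n : ℕ) (d : Fin (n + 1) → ℕ) (γ : Fin (n + 1) → ℂ) :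
    multiZetaVal n d γ 0 = (-1 / 2) ^ (n + 1) := by
  induction n with
  | zero => simp [multiZetaVal, riemannZeta_zero]
  | succ n ih =>
    simp [multiZetaVal, powThetaCoeff, riemannZeta_zero, ih]
    ring

/-- The term k = 0 multiplies the shorter value by ζ(0) = -1/2; the term k = 1 is γ ζ(-d) times the
shorter value at the origin and supplies the new summand. -/
theorem multiZetaVal_one (n : ℕ) {d : Fin (n + 1) → ℕ} (hd : ∀ j, 1 ≤ d j) (γ : Fin (n + 1) → ℂ) :
    multiZetaVal n d γ 1 = (-1 / 2) ^ n *
      ((-1) ^ d 0 * (bernoulli (d 0 + 1) : ℂ) / ((d 0 : ℂ) + 1) * γ 0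
        - ∑ j ∈ Finset.Ioi 0, (bernoulli (d j + 1) : ℂ) / ((d j : ℂ) + 1) * γ j) := by
  induction n with
  | zero =>
    have h1 : Finset.Ioi (0 : Fin 1) = ∅ := rfl
    simp only [multiZetaVal, mul_one, riemannZeta_neg_nat_eq_bernoulli, h1, Finset.sum_empty]
    ring
  | succ n ih =>
    have h1 := sum_Ioi_castSucc_fin
      (fun j => (bernoulli (d j + 1) : ℂ) / ((d j : ℂ) + 1) * γ j) (0 : Fin (n + 1))
    rw [Fin.castSucc_zero] at h1
    rw [h1, multiZetaVal, Finset.sum_range_succ, Finset.sum_range_one, ih fun j => hd _,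
      multiZetaVal_zero]
    simp only [powThetaCoeff, mul_zero, mul_one, Nat.cast_zero, neg_zero, riemannZeta_zero,
      riemannZeta_neg_eq_neg_bernoulli (hd _), Finset.prod_range_zero, Finset.prod_range_one,
      pow_zero, pow_one, Nat.factorial_zero, Nat.factorial_one, Nat.cast_one, Fin.castSucc_zero,
      div_one, Nat.cast_zero]
    ring

theorem multiZetaVal_two (n : ℕ) {d : Fin (n + 1) → ℕ} (hd : ∀ j, 1 ≤ d j) (γ : Fin (n + 1) → ℂ) :
    multiZetaVal n d γ 2 = (-1 / 2) ^ n *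
        ((bernoulli (2 * d 0 + 1) : ℂ) / (2 * (d 0 : ℂ) + 1)) * γ 0 ^ 2
      - 2 * (-1 / 2 : ℂ) ^ (((n + 1 : ℕ) : ℤ) - 2) *
        ∑ k ∈ Finset.Ioi 0, (bernoulli (d k + 1) : ℂ) / ((d k : ℂ) + 1) * γ k *
          ((-1) ^ d 0 * (bernoulli (d 0 + 1) : ℂ) / ((d 0 : ℂ) + 1) * γ 0
            - ∑ j ∈ Finset.Ioo 0 k, (bernoulli (d j + 1) : ℂ) / ((d j : ℂ) + 1) * γ j) := by
  induction n with
  | zero =>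
    have h1 : Finset.Ioi (0 : Fin 1) = ∅ := rfl
    simp only [multiZetaVal, riemannZeta_neg_nat_eq_bernoulli, h1, Finset.sum_empty,
      mul_comm (d 0) 2, pow_mul, neg_one_sq, one_pow]
    push_cast
    ring
  | succ n ih =>
    have h1 := sum_Ioi_castSucc_fin
      (fun k => (bernoulli (d k + 1) : ℂ) / ((d k : ℂ) + 1) * γ k *
          ((-1) ^ d 0 * (bernoulli (d 0 + 1) : ℂ) / ((d 0 : ℂ) + 1) * γ 0
            - ∑ j ∈ Finset.Ioo 0 k, (bernoulli (d j + 1) : ℂ) / ((d j : ℂ) + 1) * γ j))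
      (0 : Fin (n + 1))
    rw [Fin.castSucc_zero] at h1
    -- The term k = 2 drops out by a trivial zero of ζ; the term k = 1 produces the new summand of
    -- the outer sum.
    have h2 : riemannZeta (-(d (Fin.last (n + 1)) * 2 : ℕ)) = 0 := by
      have h3 := riemannZeta_neg_two_mul_nat_add_one (d (Fin.last (n + 1)) - 1)
      have h4 : ((d (Fin.last (n + 1)) - 1 : ℕ) : ℂ) + 1 = d (Fin.last (n + 1)) := by
        rw [Nat.cast_sub (hd _)]; simp
      rw [h4] at h3
      rw [← h3]
      push_cast
      congr 1
      ring
    have h5 : (-1 / 2 : ℂ) ^ (((n + 1 + 1 : ℕ) : ℤ) - 2) = (-1 / 2) ^ n := by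
      rw [← zpow_natCast]
      congr 1
      push_cast
      ring
    -- The exponent n - 1 equals -1 for n = 0, hence the integer power.
    have h6 : (-1 / 2 : ℂ) ^ (((n + 1 : ℕ) : ℤ) - 2) = -2 * (-1 / 2) ^ n := by
      have : (((n + 1 : ℕ) : ℤ) - 2) = n - 1 := by push_cast; ring
      rw [this, zpow_sub_one₀ (by norm_num), zpow_natCast]
      norm_num
      ring
    rw [h1, h5, multiZetaVal, Finset.sum_range_succ, Finset.sum_range_succ, Finset.sum_range_one,
      ih fun j => hd _, multiZetaVal_one n fun j => hd _, h6, sum_Ioo_last_fin]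
    simp only [powThetaCoeff, h2, sum_Ioo_castSucc_fin, mul_zero, mul_one, Nat.cast_zero, neg_zero,
      riemannZeta_zero, riemannZeta_neg_eq_neg_bernoulli (hd _), Finset.prod_range_zero,
      Finset.prod_range_one, pow_zero, pow_one, Nat.factorial_zero, Nat.factorial_one,
      Nat.cast_one, Fin.castSucc_zero, div_one, zero_mul, add_zero, Nat.cast_ofNat]
    ring

/-! ### Existence of the continuation and its regular values -/

/-- Every meromorphic continuation is regular at `(0, …, 0, -N)`, with value `multiZetaVal`. -/
theorem IsMultiZeta.hasRegularValueAt {n : ℕ} {d : Fin (n + 1) → ℕ} (hd : ∀ j, 1 ≤ d j)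
    {γ : Fin (n + 1) → ℂ} (hγ : ∀ j, 0 < (γ j).re) (hdε : NonIntegralSums d)
    {Z : (Fin (n + 1) → ℂ) → ℂ} (hZ : IsMultiZeta d γ Z) (N : ℕ) :
    HasRegularValueAt Z (Pi.single (Fin.last n) (-N)) (multiZetaVal n d γ N) := by
  obtain ⟨v, ⟨G, H, hG, hH, hH0, hf, hv⟩, hvN⟩ :=
    exists_hasFractionOn_multiZetaSum n hd hγ (N + 1)
  have hp : (Pi.single (Fin.last n) (-N) : Fin (n + 1) → ℂ) ∈ regularPoints d :=
    ⟨_, hdε.avoidsPoles hd N, rfl⟩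
  have hpΩ : (Pi.single (Fin.last n) (-N) : Fin (n + 1) → ℂ) ∈ tailRegion (n + 1) (N + 1) := by
    intro j
    rw [Finset.sum_pi_single', if_pos (Finset.mem_Ici.2 (Fin.le_last j)), Complex.neg_re,
      Complex.natCast_re]
    push_cast
    linarith
  refine hZ.1.hasRegularValueAt (isOpen_multiZetaDomain d) (multiZetaDomain_nonempty d)
    (convex_tailRegion _ _) (multiZetaDomain_subset_tailRegion d (N + 1)) hG hH (fun s hs => ?_)
    hpΩ (hH0 _ hp) ?_
  · rw [← hf s hs, multiZetaSum, (hZ.2 s hs).tsum_eq]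
  · rw [hv _ ⟨hp, hpΩ⟩, hvN N (Nat.lt_succ_self N)]

theorem exists_isMultiZeta {n : ℕ} {d : Fin (n + 1) → ℕ} (hd : ∀ j, 1 ≤ d j)
    {γ : Fin (n + 1) → ℂ} (hγ : ∀ j, 0 < (γ j).re) (hdε : NonIntegralSums d) :
    ∃ Z, IsMultiZeta d γ Z := by
  choose v hv _ using exists_hasFractionOn_multiZetaSum n hd hγ
  choose G H hG hH hH0 hf _ using hv
  -- The origin serves as a point where no denominator vanishes, so none of them is identically
  -- zero.
  have hp : (Pi.single (Fin.last n) (-(0 : ℕ)) : Fin (n + 1) → ℂ) ∈ regularPoints d :=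
    ⟨_, hdε.avoidsPoles hd 0, rfl⟩
  obtain ⟨Z, hZ, hZf⟩ := exists_isMeromorphicSeveral (isOpen_multiZetaDomain d)
    (multiZetaDomain_nonempty d) (isOpen_tailRegion (n + 1)) (convex_tailRegion (n + 1))
    (multiZetaDomain_subset_tailRegion d) exists_mem_tailRegion hG hH
    (fun L => ⟨_, hH0 L _ hp⟩) hf
  refine ⟨Z, hZ, fun s hs => ?_⟩
  rw [hZf s hs]
  exact (summable_multiZetaTerm hd hγ hs).hasSum

theorem corollary2 (n : ℕ) [NeZero n] (d : Fin n → ℕ) (hd : ∀ j, 1 ≤ d j)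
    (γ : Fin n → ℂ) (hγ : ∀ j, 0 < (γ j).re) (hdε : NonIntegralSums d) :
    (∃ Z : (Fin n → ℂ) → ℂ, IsMultiZeta d γ Z) ∧
    ∀ Z : (Fin n → ℂ) → ℂ, IsMultiZeta d γ Z →
      HasRegularValueAt Z 0 ((-1 / 2 : ℂ) ^ n) ∧
      HasRegularValueAt Z (Pi.single (⊤ : Fin n) (-1))
        ((-1 / 2 : ℂ) ^ (n - 1) *
          ((-1) ^ d 0 * (bernoulli (d 0 + 1) : ℂ) / ((d 0 : ℂ) + 1) * γ 0
            - ∑ j ∈ Finset.Ioi (0 : Fin n), (bernoulli (d j + 1) : ℂ) / ((d j : ℂ) + 1) * γ j)) ∧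
      HasRegularValueAt Z (Pi.single (⊤ : Fin n) (-2))
        ((-1 / 2 : ℂ) ^ (n - 1) *
            ((bernoulli (2 * d 0 + 1) : ℂ) / (2 * (d 0 : ℂ) + 1)) * γ 0 ^ 2
          - 2 * (-1 / 2 : ℂ) ^ ((n : ℤ) - 2) *
            ∑ k ∈ Finset.Ioi (0 : Fin n), (bernoulli (d k + 1) : ℂ) / ((d k : ℂ) + 1) * γ k *
              ((-1) ^ d 0 * (bernoulli (d 0 + 1) : ℂ) / ((d 0 : ℂ) + 1) * γ 0
                - ∑ j ∈ Finset.Ioo (0 : Fin n) k,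
                    (bernoulli (d j + 1) : ℂ) / ((d j : ℂ) + 1) * γ j)) := by
  obtain ⟨n, rfl⟩ : ∃ k, n = k + 1 := Nat.exists_eq_succ_of_ne_zero (NeZero.ne n)
  refine ⟨exists_isMultiZeta hd hγ hdε, fun Z hZ => ⟨?_, ?_, ?_⟩⟩
  · have h := hZ.hasRegularValueAt hd hγ hdε 0
    rw [multiZetaVal_zero, Nat.cast_zero, neg_zero, Pi.single_zero] at h
    exact h
  · have h := hZ.hasRegularValueAt hd hγ hdε 1
    rw [multiZetaVal_one n hd, Nat.cast_one] at h
    exact h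
  · have h := hZ.hasRegularValueAt hd hγ hdε 2
    rw [multiZetaVal_two n hd, Nat.cast_ofNat] at h
    exact h
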